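/- Let $\mathbb{K}$ be a field of characteristic zero; all vector spaces are over $\mathbb{K}$, gradings are by $\mathbb{Z}$ and unbounded, $\bar x$ denotes the degree of a homogeneous element $x$, and differentials have degree $+1$. For a graded vector space $V$, let $\mathbb{L}(V)$ be the free graded Lie algebra on $V$, i.e. the smallest graded Lie subalgebra of the tensor algebra $T(V)$ (with bracket the graded commutator) that contains $V$. A morphism $f\colon A\to B$ of DG-Lie algebras is an *elementary semifree extension* if there are a graded vector space $V$ and an isomorphism of graded Lie algebras $B\cong A\amalg\mathbb{L}(V)$ (coproduct of graded Lie algebras) that identifies $f$ with the inclusion of $A$ and is such that $d(V)\subseteq A$. A *semifree extension* is a countable composition of elementary semifree extensions, i.e. the canonical morphism $A_0\to\operatorname{colim}_n A_n$ for a sequence $A_0\to A_1\to A_2\to\cdots$ of elementary semifree extensions. A DG-Lie algebra $L$ is *semifree* if the initial map $0\to L$ is a semifree extension. Let $(C,\Delta)$ be a coassociative graded coalgebra (not necessarily counital) with $\Delta\colon C\to C\otimes C$ of degree $0$, which is graded cocommutative, i.e. $\mathrm{tw}\circ\Delta=\Delta$ for $\mathrm{tw}(x\otimes y)=(-1)^{\bar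 x\,\bar y}\,y\otimes x$, and locally conilpotent, i.e. $C=\bigcup_{n\ge 0}\ker\Delta^n$ where $\Delta^0=\mathrm{id}$ and $\Delta^{n}=(\mathrm{id}\otimes\Delta^{n-1})\circ\Delta\colon C\to C^{\otimes n+1}$ for $n\ge 1$. Let $C[-1]$ be the graded vector space with $C[-1]^n=C^{n-1}$, and $s\colon C\to C[-1]$ the suspension. The cobar construction $\mathcal{L}(C)$ is the DG-Lie algebra $\mathbb{L}(C[-1])$ whose differential is the restriction of the derivation $d$ of $T(C[-1])$ with $$d(sx)=\sum_i(-1)^{\bar x_i}\,sx_i\otimes sx_i'=\frac12\sum_i(-1)^{\bar x_i}[sx_i,sx_i']\qquad\text{for }\Delta(x)=\sum_i x_i\otimes x_i'\ \ (x_i, x_i' \text{ homogeneous}).$$ Then $\mathcal{L}(C)$ is a semifree DG-Lie algebra. -/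

import Mathlib

universe u v

noncomputable section

namespace DGLieCobar

open CategoryTheory TensorProduct

/-! ### Graded vector spaces -/

/-- A `ℤ`-graded vector space `V = ⨁ n, Vⁿ` over `K`. -/
structure GrMod (K : Type u) [Field K] where
  carrier : Type v
  [addCommGroup : AddCommGroup carrier]
  [module : Module K carrier]
  /-- the homogeneous components -/
  gr : ℤ → Submodule K carrier
  internal : DirectSum.IsInternal gr

attribute [instance] GrMod.addCommGroup GrMod.module

namespace GrMod

variable {K : Type u} [Field K]

instance : CoeSort (GrMod.{u, v} K) (Type v) := ⟨GrMod.carrier⟩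

instance decomposition (V : GrMod.{u, v} K) : DirectSum.Decomposition V.gr :=
  V.internal.chooseDecomposition

/-- The linear map out of `V` given by a linear map on each homogeneous component. -/
def desc (V : GrMod.{u, v} K) {W : Type*} [AddCommMonoid W] [Module K W]
    (f : ∀ i, V.gr i →ₗ[K] W) : V →ₗ[K] W :=
  DirectSum.toModule K ℤ W f ∘ₗ (DirectSum.decomposeLinearEquiv V.gr).toLinearMap

theorem desc_of_mem (V : GrMod.{u, v} K) {W : Type*} [AddCommMonoid W] [Module K W]
    (f : ∀ i, V.gr i →ₗ[K] W) {i : ℤ} {x : V} (hx : x ∈ V.gr i) : V.desc f x = f i ⟨x, hx⟩ := by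
  have := DirectSum.decompose_of_mem V.gr hx
  simp only [desc, LinearMap.comp_apply, LinearEquiv.coe_coe,
    DirectSum.decomposeLinearEquiv_apply, this]
  exact DirectSum.toModule_lof K i _

theorem induction (V : GrMod.{u, v} K) {P : V → Prop} (h0 : P 0)
    (hom : ∀ i, ∀ x ∈ V.gr i, P x) (hadd : ∀ x y, P x → P y → P (x + y)) (x : V) : P x :=
  DirectSum.Decomposition.inductionOn V.gr h0 (fun m => hom _ m m.2) hadd x

theorem hom_ext (V : GrMod.{u, v} K) {W : Type*} [AddCommMonoid W] [Module K W]
    {f g : V →ₗ[K] W} (h : ∀ i, ∀ x ∈ V.gr i, f x = g x) : f = g := by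
  ext x
  induction x using V.induction with
  | h0 => simp
  | hom i x hx => exact h i x hx
  | hadd x y hx hy => simp [hx, hy]

/-- The operator `y ↦ (-1) ^ (i * deg y) y`. -/
def sgn (V : GrMod.{u, v} K) (i : ℤ) : V →ₗ[K] V :=
  V.desc fun j => (((i * j).negOnePow : ℤˣ) : ℤ) • (V.gr j).subtype

theorem sgn_of_mem (V : GrMod.{u, v} K) (i : ℤ) {j : ℤ} {x : V} (hx : x ∈ V.gr j) :
    V.sgn i x = (((i * j).negOnePow : ℤˣ) : ℤ) • x := by
  rw [sgn, desc_of_mem V _ hx]; rfl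

theorem sgn_mem (V : GrMod.{u, v} K) (i : ℤ) {j : ℤ} {x : V} (hx : x ∈ V.gr j) :
    V.sgn i x ∈ V.gr j := by
  rw [sgn_of_mem V i hx]; exact zsmul_mem hx _

/-- The bilinear map `(x, y) ↦ (-1) ^ (deg x * deg y) μ (y, x)` associated to a bilinear
map `μ`. -/
def koszulFlip (V : GrMod.{u, v} K) {W : Type*} [AddCommMonoid W] [Module K W]
    (μ : V →ₗ[K] V →ₗ[K] W) : V →ₗ[K] V →ₗ[K] W :=
  V.desc fun i => (LinearMap.lcomp K W (V.sgn i) ∘ₗ μ.flip) ∘ₗ (V.gr i).subtype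

theorem koszulFlip_of_mem (V : GrMod.{u, v} K) {W : Type*} [AddCommGroup W] [Module K W]
    (μ : V →ₗ[K] V →ₗ[K] W) {i j : ℤ} {x y : V} (hx : x ∈ V.gr i) (hy : y ∈ V.gr j) :
    V.koszulFlip μ x y = (((i * j).negOnePow : ℤˣ) : ℤ) • μ y x := by
  rw [koszulFlip, desc_of_mem V _ hx]
  simp [sgn_of_mem V i hy, LinearMap.lcomp_apply]

/-- The projection onto the homogeneous component of degree `n`. -/
def proj (V : GrMod.{u, v} K) (n : ℤ) : V →ₗ[K] V :=
  (V.gr n).subtype ∘ₗ DirectSum.component K ℤ (fun i => V.gr i) n ∘ₗ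
    (DirectSum.decomposeLinearEquiv V.gr).toLinearMap

theorem proj_mem (V : GrMod.{u, v} K) (n : ℤ) (x : V) : V.proj n x ∈ V.gr n :=
  (DirectSum.decompose V.gr x n).2

theorem proj_of_mem (V : GrMod.{u, v} K) {n : ℤ} {x : V} (hx : x ∈ V.gr n) : V.proj n x = x :=
  DirectSum.decompose_of_mem_same V.gr hx

theorem proj_of_mem_ne (V : GrMod.{u, v} K) {m n : ℤ} {x : V} (hx : x ∈ V.gr m) (h : m ≠ n) :
    V.proj n x = 0 :=
  DirectSum.decompose_of_mem_ne V.gr hx h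

theorem exists_sum_proj (V : GrMod.{u, v} K) (x : V) :
    ∃ s : Finset ℤ, ∑ i ∈ s, V.proj i x = x := by
  classical
  exact ⟨_, DirectSum.sum_support_decompose V.gr x⟩

/-- The shift `V[-1]`, with `V[-1]ⁿ = Vⁿ⁻¹`. The suspension `s : V → V[-1]` is the identity of
the underlying vector space. -/
abbrev shift (V : GrMod.{u, v} K) : GrMod.{u, v} K where
  carrier := V
  gr n := V.gr (n - 1)
  internal := by
    rw [DirectSum.isInternal_submodule_iff_iSupIndep_and_iSup_eq_top]
    have h := (DirectSum.isInternal_submodule_iff_iSupIndep_and_iSup_eq_top V.gr).1 V.internal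
    refine ⟨h.1.comp (f := fun n : ℤ => n - 1) (sub_left_injective), ?_⟩
    rw [← h.2]
    exact (Equiv.subRight (1 : ℤ)).iSup_comp (g := V.gr)

/-- A subspace is graded if it contains the homogeneous components of its elements. -/
def IsGraded (V : GrMod.{u, v} K) (S : Submodule K V) : Prop :=
  ∀ x ∈ S, ∀ n, V.proj n x ∈ S

/-- A graded subspace `S`, as a graded vector space with `Sⁿ = S ∩ Vⁿ`. -/
abbrev sub (V : GrMod.{u, v} K) (S : Submodule K V) (hS : V.IsGraded S) : GrMod.{u, v} K where
  carrier := S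
  gr n := (V.gr n).comap S.subtype
  internal := by
    classical
    rw [DirectSum.isInternal_submodule_iff_iSupIndep_and_iSup_eq_top]
    have h := (DirectSum.isInternal_submodule_iff_iSupIndep_and_iSup_eq_top V.gr).1 V.internal
    constructor
    · rw [iSupIndep_iff_finsetSum_eq_zero_imp_eq_zero]
      have h1 := (iSupIndep_iff_finsetSum_eq_zero_imp_eq_zero V.gr).1 h.1
      intro s w hw h0 i hi
      refine Subtype.ext (h1 s (fun i => (w i : V)) (fun i hi => hw i hi) ?_ i hi)
      rw [← AddSubmonoidClass.coe_finsetSum, h0]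
      rfl
    · rw [eq_top_iff]
      rintro x -
      obtain ⟨s, hs⟩ := V.exists_sum_proj (x : V)
      have hx : x = ∑ i ∈ s, (⟨V.proj i (x : V), hS _ x.2 i⟩ : S) := by
        apply Subtype.ext
        rw [AddSubmonoidClass.coe_finsetSum]
        exact hs.symm
      rw [hx]
      exact Submodule.sum_mem _ fun i _ => Submodule.mem_iSup_of_mem i (V.proj_mem i x)

variable (V : GrMod.{u, v} K)

/-! ### The tensor algebra and the free graded Lie algebra -/

/-- `IsMonomial V n x` says that `x = v₁ ⊗ ⋯ ⊗ vₖ` with homogeneous `vᵢ ∈ V` whose degrees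
add up to `n`. -/
inductive IsMonomial (V : GrMod.{u, v} K) : ℤ → TensorAlgebra K V → Prop
  | one : IsMonomial V 0 1
  | mul {i n : ℤ} {w : V} {x : TensorAlgebra K V} (hw : w ∈ V.gr i) (hx : IsMonomial V n x) :
      IsMonomial V (i + n) (TensorAlgebra.ι K w * x)

/-- The grading of `T(V)` induced by the grading of `V`. -/
def tensorAlgebraGr (n : ℤ) : Submodule K (TensorAlgebra K V) :=
  Submodule.span K {x | V.IsMonomial n x}

variable {V} in
theorem IsMonomial.mul_mem {m n : ℤ} {x y : TensorAlgebra K V} (hx : V.IsMonomial m x)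
    (hy : V.IsMonomial n y) : V.IsMonomial (m + n) (x * y) := by
  induction hx with
  | one => simpa using hy
  | mul hw _ ih => rw [add_assoc, mul_assoc]; exact .mul hw ih

instance : SetLike.GradedMonoid V.tensorAlgebraGr where
  one_mem := Submodule.subset_span .one
  mul_mem {m n x y} hx hy := by
    have := Submodule.mul_mem_mul hx hy
    rw [tensorAlgebraGr, tensorAlgebraGr, Submodule.span_mul_span] at this
    refine Submodule.span_mono ?_ this
    rintro _ ⟨a, ha, b, hb, rfl⟩
    exact IsMonomial.mul_mem ha hb

variable {V} in
theorem ι_mem {i : ℤ} {w : V} (hw : w ∈ V.gr i) :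
    TensorAlgebra.ι K w ∈ V.tensorAlgebraGr i := by
  have := IsMonomial.mul hw .one
  rw [add_zero, mul_one] at this
  exact Submodule.subset_span this

/-- Auxiliary linear map for the decomposition of `T(V)`. -/
def ιDecomp : V →ₗ[K] DirectSum ℤ fun i => V.tensorAlgebraGr i :=
  V.desc fun i => DirectSum.lof K ℤ (fun i => V.tensorAlgebraGr i) i ∘ₗ
    ((TensorAlgebra.ι K ∘ₗ (V.gr i).subtype).codRestrict _ fun x => ι_mem x.2)

theorem ιDecomp_of_mem {i : ℤ} {w : V} (hw : w ∈ V.gr i) :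
    V.ιDecomp w = DirectSum.of (fun i => V.tensorAlgebraGr i) i
      ⟨TensorAlgebra.ι K w, ι_mem hw⟩ := by
  rw [ιDecomp, desc_of_mem V _ hw]; rfl

theorem tensorAlgebra_isInternal : DirectSum.IsInternal V.tensorAlgebraGr := by
  have key : ∀ {n : ℤ} {x : TensorAlgebra K V} (h : V.IsMonomial n x),
      TensorAlgebra.lift K V.ιDecomp x =
        DirectSum.of (fun i => V.tensorAlgebraGr i) n ⟨x, Submodule.subset_span h⟩ := by
    intro n x h
    induction h with
    | one => rw [map_one]; rfl
    | mul hw hx ih =>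
      rw [map_mul, ih, TensorAlgebra.lift_ι_apply, ιDecomp_of_mem V hw, DirectSum.of_mul_of]
      rfl
  let _ : GradedAlgebra V.tensorAlgebraGr :=
    GradedAlgebra.ofAlgHom _ (TensorAlgebra.lift K V.ιDecomp)
      (by
        apply TensorAlgebra.hom_ext
        refine V.hom_ext fun i x hx => ?_
        simp [ιDecomp_of_mem V hx])
      (by
        rintro i ⟨x, hx⟩
        dsimp only
        induction hx using Submodule.span_induction with
        | mem x h => exact key h
        | zero => rw [map_zero]; exact (map_zero _).symm
        | add x y hx hy ihx ihy => rw [map_add, ihx, ihy, ← map_add]; rfl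
        | smul a x hx ih =>
          rw [map_smul, ih]
          exact ((DirectSum.lof K ℤ (fun i => V.tensorAlgebraGr i) i).map_smul a ⟨x, hx⟩).symm)
  exact DirectSum.Decomposition.isInternal _

/-- The tensor algebra `T(V)` as a graded vector space. -/
abbrev tensorAlgebra : GrMod.{u, max u v} K where
  carrier := TensorAlgebra K V
  gr := V.tensorAlgebraGr
  internal := V.tensorAlgebra_isInternal

/-- The graded commutator `[a, b] = a b - (-1) ^ (deg a * deg b) b a` on `T(V)`. -/
def comm : TensorAlgebra K V →ₗ[K] TensorAlgebra K V →ₗ[K] TensorAlgebra K V :=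
  LinearMap.mul K (TensorAlgebra K V) -
    V.tensorAlgebra.koszulFlip (LinearMap.mul K (TensorAlgebra K V))

theorem comm_of_mem {i j : ℤ} {a b : TensorAlgebra K V} (ha : a ∈ V.tensorAlgebraGr i)
    (hb : b ∈ V.tensorAlgebraGr j) :
    V.comm a b = a * b - (((i * j).negOnePow : ℤˣ) : ℤ) • (b * a) := by
  have := V.tensorAlgebra.koszulFlip_of_mem (LinearMap.mul K (TensorAlgebra K V)) ha hb
  rw [comm, LinearMap.sub_apply, LinearMap.sub_apply, this]
  rfl

theorem mul_mem_gr {i j : ℤ} {a b : TensorAlgebra K V} (ha : a ∈ V.tensorAlgebraGr i)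
    (hb : b ∈ V.tensorAlgebraGr j) : a * b ∈ V.tensorAlgebraGr (i + j) :=
  SetLike.GradedMul.mul_mem ha hb

theorem comm_mem {i j : ℤ} {a b : TensorAlgebra K V} (ha : a ∈ V.tensorAlgebraGr i)
    (hb : b ∈ V.tensorAlgebraGr j) : V.comm a b ∈ V.tensorAlgebraGr (i + j) := by
  rw [comm_of_mem V ha hb]
  refine sub_mem (V.mul_mem_gr ha hb) (zsmul_mem ?_ _)
  rw [add_comm]
  exact V.mul_mem_gr hb ha

theorem comm_skew {i j : ℤ} {a b : TensorAlgebra K V} (ha : a ∈ V.tensorAlgebraGr i)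
    (hb : b ∈ V.tensorAlgebraGr j) :
    V.comm a b = -((((i * j).negOnePow : ℤˣ) : ℤ) • V.comm b a) := by
  rw [comm_of_mem V ha hb, comm_of_mem V hb ha, mul_comm j i]
  rcases Int.units_eq_one_or (i * j).negOnePow with h | h <;> simp [h]

theorem comm_jacobi {i j k : ℤ} {a b c : TensorAlgebra K V} (ha : a ∈ V.tensorAlgebraGr i)
    (hb : b ∈ V.tensorAlgebraGr j) (hc : c ∈ V.tensorAlgebraGr k) :
    V.comm a (V.comm b c) =
      V.comm (V.comm a b) c + (((i * j).negOnePow : ℤˣ) : ℤ) • V.comm b (V.comm a c) := by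
  rw [comm_of_mem V ha (V.comm_mem hb hc), comm_of_mem V (V.comm_mem ha hb) hc,
    comm_of_mem V hb (V.comm_mem ha hc), comm_of_mem V ha hb, comm_of_mem V hb hc,
    comm_of_mem V ha hc]
  simp only [mul_add, add_mul, Int.negOnePow_add]
  rw [mul_comm j i]
  rcases Int.units_eq_one_or (i * j).negOnePow with h | h <;>
  rcases Int.units_eq_one_or (i * k).negOnePow with h' | h' <;>
  rcases Int.units_eq_one_or (j * k).negOnePow with h'' | h'' <;>
  simp only [h, h', h'', mul_one, Units.val_one, Units.val_neg, one_smul, neg_smul, mul_neg,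
    neg_neg] <;>
  noncomm_ring

/-- A graded Lie subalgebra of `T(V)` with the graded commutator, containing `V`. -/
structure IsLieSubalgebraOver (S : Submodule K (TensorAlgebra K V)) : Prop where
  graded : V.tensorAlgebra.IsGraded S
  comm_mem : ∀ a ∈ S, ∀ b ∈ S, V.comm a b ∈ S
  ι_mem : ∀ w : V, TensorAlgebra.ι K w ∈ S

/-- The underlying space of the free graded Lie algebra `𝕃(V)`: the intersection of all the graded
Lie subalgebras of `T(V)` containing `V`. -/
def freeLieSub : Submodule K (TensorAlgebra K V) :=
  sInf {S | V.IsLieSubalgebraOver S}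

theorem isLieSubalgebraOver_freeLieSub : V.IsLieSubalgebraOver V.freeLieSub where
  graded x hx n := by
    exact (Submodule.mem_sInf).2 fun S hS => hS.graded x ((Submodule.mem_sInf).1 hx S hS) n
  comm_mem a ha b hb := by
    rw [freeLieSub, Submodule.mem_sInf] at ha hb ⊢
    exact fun S hS => hS.comm_mem a (ha S hS) b (hb S hS)
  ι_mem w := by
    rw [freeLieSub, Submodule.mem_sInf]
    exact fun S hS => hS.ι_mem w

variable {V} in
theorem freeLieSub_le {S : Submodule K (TensorAlgebra K V)} (hS : V.IsLieSubalgebraOver S) :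
    V.freeLieSub ≤ S :=
  sInf_le hS

end GrMod

/-! ### Graded Lie algebras and DG-Lie algebras -/

/-- A graded Lie algebra over `K`. -/
structure GrLie (K : Type u) [Field K] extends GrMod.{u, v} K where
  bracket : carrier →ₗ[K] carrier →ₗ[K] carrier
  bracket_mem : ∀ {i j : ℤ} {x y : carrier}, x ∈ gr i → y ∈ gr j → bracket x y ∈ gr (i + j)
  skew : ∀ {i j : ℤ} {x y : carrier}, x ∈ gr i → y ∈ gr j →
    bracket x y = -((((i * j).negOnePow : ℤˣ) : ℤ) • bracket y x)
  jacobi : ∀ {i j k : ℤ} {x y z : carrier}, x ∈ gr i → y ∈ gr j → z ∈ gr k →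
    bracket x (bracket y z) =
      bracket (bracket x y) z + (((i * j).negOnePow : ℤˣ) : ℤ) • bracket y (bracket x z)

/-- A DG-Lie algebra over `K`, with differential of degree `1`. -/
structure DGLie (K : Type u) [Field K] extends GrLie.{u, v} K where
  d : carrier →ₗ[K] carrier
  d_mem : ∀ {i : ℤ} {x : carrier}, x ∈ gr i → d x ∈ gr (i + 1)
  d_d : ∀ x : carrier, d (d x) = 0
  leibniz : ∀ {i j : ℤ} {x y : carrier}, x ∈ gr i → y ∈ gr j →
    d (bracket x y) = bracket (d x) y + ((i.negOnePow : ℤˣ) : ℤ) • bracket x (d y)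

section Categories

variable {K : Type u} [Field K]

instance : CoeSort (GrLie.{u, v} K) (Type v) := ⟨fun L => L.carrier⟩
instance : CoeSort (DGLie.{u, v} K) (Type v) := ⟨fun L => L.carrier⟩

/-- Morphisms of graded Lie algebras. -/
@[ext]
structure GrLie.Hom (A B : GrLie.{u, v} K) where
  toLinearMap : A →ₗ[K] B
  map_gr : ∀ {i : ℤ} {x : A}, x ∈ A.gr i → toLinearMap x ∈ B.gr i
  map_bracket : ∀ x y : A,
    toLinearMap (A.bracket x y) = B.bracket (toLinearMap x) (toLinearMap y)

/-- Morphisms of DG-Lie algebras. -/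
@[ext]
structure DGLie.Hom (A B : DGLie.{u, v} K) extends GrLie.Hom A.toGrLie B.toGrLie where
  map_d : ∀ x : A, toLinearMap (A.d x) = B.d (toLinearMap x)

/-- The category of graded Lie algebras. -/
instance : Category (GrLie.{u, v} K) where
  Hom := GrLie.Hom
  id A := ⟨LinearMap.id, fun h => h, fun _ _ => rfl⟩
  comp f g := ⟨g.toLinearMap ∘ₗ f.toLinearMap, fun h => g.map_gr (f.map_gr h),
    fun x y => by simp [f.map_bracket, g.map_bracket]⟩

/-- The category of DG-Lie algebras. -/
instance : Category (DGLie.{u, v} K) where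
  Hom := DGLie.Hom
  id A := ⟨𝟙 A.toGrLie, fun _ => rfl⟩
  comp {A B C} f g := ⟨(f.toHom ≫ g.toHom : A.toGrLie ⟶ C.toGrLie), fun x => by
    change g.toLinearMap (f.toLinearMap _) = C.d (g.toLinearMap (f.toLinearMap x))
    rw [f.map_d, g.map_d]⟩

/-- The morphism of graded Lie algebras underlying a morphism of DG-Lie algebras. -/
def DGLie.grHom {A B : DGLie.{u, v} K} (f : A ⟶ B) : A.toGrLie ⟶ B.toGrLie :=
  GrLie.Hom.mk f.toLinearMap f.map_gr f.map_bracket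

/-- The free graded Lie algebra `𝕃(V) ⊆ T(V)` on a graded vector space `V`. -/
def freeLie (V : GrMod.{u, v} K) : GrLie.{u, max u v} K where
  toGrMod := V.tensorAlgebra.sub V.freeLieSub V.isLieSubalgebraOver_freeLieSub.graded
  bracket :=
    LinearMap.mk₂ K (fun a b => (⟨V.comm a.1 b.1,
        V.isLieSubalgebraOver_freeLieSub.comm_mem _ a.2 _ b.2⟩ : V.freeLieSub))
      (fun a b c => Subtype.ext (LinearMap.map_add₂ V.comm a.1 b.1 c.1))
      (fun r a b => Subtype.ext (LinearMap.map_smul₂ V.comm r a.1 b.1))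
      (fun a b c => Subtype.ext (map_add (V.comm a.1) b.1 c.1))
      (fun r a b => Subtype.ext (map_smul (V.comm a.1) r b.1))
  bracket_mem hx hy := V.comm_mem hx hy
  skew hx hy := Subtype.ext (V.comm_skew hx hy)
  jacobi hx hy hz := Subtype.ext (V.comm_jacobi hx hy hz)

/-- The inclusion `V → 𝕃(V)`. -/
def freeLie.ι (V : GrMod.{u, v} K) : V →ₗ[K] freeLie V :=
  (TensorAlgebra.ι K).codRestrict V.freeLieSub V.isLieSubalgebraOver_freeLieSub.ι_mem

end Categories

/-! ### Derivations of the tensor algebra -/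

namespace GrMod

variable {K : Type u} [Field K] (V : GrMod.{u, v} K)

/-- The operator `x ↦ (-1) ^ (deg x) x` on `T(V)`. -/
def parity : TensorAlgebra K V →ₐ[K] TensorAlgebra K V :=
  TensorAlgebra.lift K (TensorAlgebra.ι K ∘ₗ V.sgn 1)

/-- The algebra map `x ↦ ((-1) ^ (deg x) x, D x; 0, x)` into upper triangular matrices, where
`D` is the derivation extending `f`. -/
def derMatrix (f : V →ₗ[K] TensorAlgebra K V) :
    TensorAlgebra K V →ₐ[K] Matrix (Fin 2) (Fin 2) (TensorAlgebra K V) :=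
  TensorAlgebra.lift K
    { toFun := fun w => !![TensorAlgebra.ι K (V.sgn 1 w), f w; 0, TensorAlgebra.ι K w]
      map_add' := fun x y => by ext i j; fin_cases i <;> fin_cases j <;> simp
      map_smul' := fun r x => by ext i j; fin_cases i <;> fin_cases j <;> simp }

/-- The extension of a linear map `f : V → T(V)` of degree `1` to `T(V)` by the Leibniz rule
`D (a b) = D a b + (-1) ^ (deg a) a D b`. -/
def der (f : V →ₗ[K] TensorAlgebra K V) : TensorAlgebra K V →ₗ[K] TensorAlgebra K V :=
  Matrix.entryLinearMap K (TensorAlgebra K V) 0 1 ∘ₗ (V.derMatrix f).toLinearMap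

theorem derMatrix_eq (f : V →ₗ[K] TensorAlgebra K V) (a : TensorAlgebra K V) :
    V.derMatrix f a = !![V.parity a, V.der f a; 0, a] := by
  have hd : ∀ a, V.der f a = V.derMatrix f a 0 1 := fun _ => rfl
  have key : V.derMatrix f a 0 0 = V.parity a ∧ V.derMatrix f a 1 0 = 0 ∧
      V.derMatrix f a 1 1 = a := by
    induction a using TensorAlgebra.induction with
    | algebraMap r =>
      simp [Matrix.algebraMap_matrix_apply]
    | ι x => simp [derMatrix, parity]
    | mul a b ha hb =>
      simp only [map_mul, Matrix.mul_apply, Fin.sum_univ_two, ha, hb]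
      simp
    | add a b ha hb =>
      simp only [map_add, Matrix.add_apply, ha, hb]
      simp
  ext i j
  fin_cases i <;> fin_cases j <;> simp [key, hd]

@[simp]
theorem der_ι (f : V →ₗ[K] TensorAlgebra K V) (w : V) : V.der f (TensorAlgebra.ι K w) = f w := by
  simp [der, derMatrix]

theorem der_mul_parity (f : V →ₗ[K] TensorAlgebra K V) (a b : TensorAlgebra K V) :
    V.der f (a * b) = V.der f a * b + V.parity a * V.der f b := by
  have h : V.derMatrix f (a * b) 0 1 = (V.derMatrix f a * V.derMatrix f b) 0 1 := by
    rw [map_mul]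
  rw [derMatrix_eq, derMatrix_eq, derMatrix_eq] at h
  simpa [Matrix.mul_apply, Fin.sum_univ_two, add_comm] using h

@[simp]
theorem der_algebraMap (f : V →ₗ[K] TensorAlgebra K V) (r : K) :
    V.der f (algebraMap K _ r) = 0 := by
  change V.derMatrix f (algebraMap K _ r) 0 1 = 0
  rw [AlgHom.commutes, Matrix.algebraMap_matrix_apply]
  rfl

theorem parity_of_mem {n : ℤ} {a : TensorAlgebra K V} (ha : a ∈ V.tensorAlgebraGr n) :
    V.parity a = ((n.negOnePow : ℤˣ) : ℤ) • a := by
  induction ha using Submodule.span_induction with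
  | mem x h =>
    induction h with
    | one => simp
    | @mul i n w x hw hx ih =>
      rw [map_mul, ih, parity, TensorAlgebra.lift_ι_apply, LinearMap.comp_apply,
        V.sgn_of_mem 1 hw, Int.negOnePow_add, map_zsmul, one_mul]
      rw [Units.val_mul, smul_mul_smul_comm]
  | zero => simp
  | add x y _ _ hx hy => simp [hx, hy]
  | smul r x _ hx => rw [map_smul, hx, smul_comm]

theorem der_mul (f : V →ₗ[K] TensorAlgebra K V) {n : ℤ} {a : TensorAlgebra K V}
    (ha : a ∈ V.tensorAlgebraGr n) (b : TensorAlgebra K V) :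
    V.der f (a * b) = V.der f a * b + ((n.negOnePow : ℤˣ) : ℤ) • (a * V.der f b) := by
  rw [der_mul_parity, parity_of_mem V ha, smul_mul_assoc]

/-- `f : V → T(V)` has degree `1`. -/
def IsDegreeOne (f : V →ₗ[K] TensorAlgebra K V) : Prop :=
  ∀ i, ∀ w ∈ V.gr i, f w ∈ V.tensorAlgebraGr (i + 1)

variable {V} in
theorem der_mem {f : V →ₗ[K] TensorAlgebra K V} (hf : V.IsDegreeOne f) {n : ℤ}
    {a : TensorAlgebra K V} (ha : a ∈ V.tensorAlgebraGr n) :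
    V.der f a ∈ V.tensorAlgebraGr (n + 1) := by
  induction ha using Submodule.span_induction with
  | mem x h =>
    induction h with
    | one => simpa using V.der_algebraMap f 1 ▸ Submodule.zero_mem _
    | @mul i n w x hw hx ih =>
      rw [V.der_mul f (ι_mem hw), der_ι]
      refine add_mem ?_ (zsmul_mem ?_ _)
      · have := V.mul_mem_gr (hf i w hw) (Submodule.subset_span hx)
        rwa [show i + 1 + n = i + n + 1 by ring] at this
      · have := V.mul_mem_gr (ι_mem hw) ih
        rwa [← add_assoc] at this
  | zero => simp
  | add x y _ _ hx hy => rw [map_add]; exact add_mem hx hy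
  | smul r x _ hx => rw [map_smul]; exact Submodule.smul_mem _ r hx

variable {V} in
theorem parity_der {f : V →ₗ[K] TensorAlgebra K V} (hf : V.IsDegreeOne f)
    (a : TensorAlgebra K V) : V.parity (V.der f a) = -V.der f (V.parity a) := by
  have h : V.parity.toLinearMap ∘ₗ V.der f = -(V.der f ∘ₗ V.parity.toLinearMap) := by
    refine V.tensorAlgebra.hom_ext fun i x hx => ?_
    simp only [LinearMap.comp_apply, LinearMap.neg_apply, AlgHom.toLinearMap_apply]
    rw [parity_of_mem V hx, parity_of_mem V (der_mem hf hx), Int.negOnePow_succ, map_zsmul,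
      Units.val_neg, neg_smul]
  exact LinearMap.congr_fun h a

theorem parity_parity (a : TensorAlgebra K V) : V.parity (V.parity a) = a := by
  have h : V.parity.toLinearMap ∘ₗ V.parity.toLinearMap = LinearMap.id := by
    refine V.tensorAlgebra.hom_ext fun i x hx => ?_
    simp only [LinearMap.comp_apply, AlgHom.toLinearMap_apply, LinearMap.id_apply]
    rw [parity_of_mem V hx, map_zsmul, parity_of_mem V hx, smul_smul]
    rcases Int.units_eq_one_or i.negOnePow with h | h <;> simp [h]
  exact LinearMap.congr_fun h a

variable {V} in
theorem der_der {f : V →ₗ[K] TensorAlgebra K V} (hf : V.IsDegreeOne f)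
    (h0 : ∀ w, V.der f (f w) = 0) (a : TensorAlgebra K V) : V.der f (V.der f a) = 0 := by
  induction a using TensorAlgebra.induction with
  | algebraMap r => simp
  | ι x => simp [h0]
  | mul a b ha hb =>
    rw [der_mul_parity, map_add, der_mul_parity, der_mul_parity, ha, hb, parity_der hf]
    simp
  | add a b ha hb => simp [ha, hb]

variable {V} in
theorem der_comm {f : V →ₗ[K] TensorAlgebra K V} (hf : V.IsDegreeOne f) {i j : ℤ}
    {a b : TensorAlgebra K V} (ha : a ∈ V.tensorAlgebraGr i) (hb : b ∈ V.tensorAlgebraGr j) :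
    V.der f (V.comm a b) =
      V.comm (V.der f a) b + ((i.negOnePow : ℤˣ) : ℤ) • V.comm a (V.der f b) := by
  rw [comm_of_mem V ha hb, comm_of_mem V (der_mem hf ha) hb, comm_of_mem V ha (der_mem hf hb),
    map_sub, map_zsmul, der_mul V f ha, der_mul V f hb]
  simp only [mul_add, add_mul, Int.negOnePow_add, mul_one, one_mul]
  rcases Int.units_eq_one_or (i * j).negOnePow with h | h <;>
  rcases Int.units_eq_one_or i.negOnePow with h' | h' <;>
  rcases Int.units_eq_one_or j.negOnePow with h'' | h'' <;>
  simp only [h, h', h'', mul_one, Units.val_one, Units.val_neg, one_smul, neg_smul,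
    mul_neg, neg_neg] <;>
  abel

variable {V} in
theorem der_comm_parity {f : V →ₗ[K] TensorAlgebra K V} (hf : V.IsDegreeOne f)
    (a b : TensorAlgebra K V) :
    V.der f (V.comm a b) = V.comm (V.der f a) b + V.comm (V.parity a) (V.der f b) := by
  induction a using V.tensorAlgebra.induction with
  | h0 => simp
  | hom i x hx =>
    induction b using V.tensorAlgebra.induction with
    | h0 => simp
    | hom j y hy =>
      rw [der_comm hf hx hy, parity_of_mem V hx, LinearMap.map_smul_of_tower, LinearMap.smul_apply]
    | hadd y z hy hz =>
      have e : ∀ t : TensorAlgebra K V, V.comm t (y + z) = V.comm t y + V.comm t z :=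
        fun t => map_add _ _ _
      have e' : V.der f (y + z) = V.der f y + V.der f z := map_add _ _ _
      rw [e, e, e', map_add, map_add, hy, hz]
      abel
  | hadd x z hx hz =>
    have e : V.comm (x + z) b = V.comm x b + V.comm z b := LinearMap.map_add₂ _ _ _ _
    have e' : V.der f (x + z) = V.der f x + V.der f z := map_add _ _ _
    have e'' : V.parity (x + z) = V.parity x + V.parity z := map_add _ _ _
    rw [e, e', e'', map_add, LinearMap.map_add₂, LinearMap.map_add₂, hx, hz]
    abel

theorem parity_mem_freeLieSub {a : TensorAlgebra K V} (ha : a ∈ V.freeLieSub) :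
    V.parity a ∈ V.freeLieSub := by
  classical
  obtain ⟨s, hs⟩ := V.tensorAlgebra.exists_sum_proj a
  have h2 : V.parity a = ∑ i ∈ s, V.parity (V.tensorAlgebra.proj i a) := by
    rw [← map_sum]; exact congrArg _ hs.symm
  rw [h2]
  refine sum_mem fun i _ => ?_
  rw [parity_of_mem V (V.tensorAlgebra.proj_mem i a)]
  exact zsmul_mem (V.isLieSubalgebraOver_freeLieSub.graded a ha i) _

variable {V} in
theorem der_mem_freeLieSub {f : V →ₗ[K] TensorAlgebra K V} (hf : V.IsDegreeOne f)
    (hL : ∀ w, f w ∈ V.freeLieSub) {a : TensorAlgebra K V} (ha : a ∈ V.freeLieSub) :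
    V.der f a ∈ V.freeLieSub := by
  classical
  have hF := V.isLieSubalgebraOver_freeLieSub
  have hcomp : ∀ (a : TensorAlgebra K V) (n : ℤ),
      V.der f (V.tensorAlgebra.proj n a) = V.tensorAlgebra.proj (n + 1) (V.der f a) := by
    intro a n
    suffices h : V.der f ∘ₗ V.tensorAlgebra.proj n = V.tensorAlgebra.proj (n + 1) ∘ₗ V.der f from
      LinearMap.congr_fun h a
    refine V.tensorAlgebra.hom_ext fun i x hx => ?_
    rw [LinearMap.comp_apply, LinearMap.comp_apply]
    by_cases h : i = n
    · subst h
      rw [V.tensorAlgebra.proj_of_mem hx, V.tensorAlgebra.proj_of_mem (der_mem hf hx)]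
    · rw [V.tensorAlgebra.proj_of_mem_ne hx h,
        V.tensorAlgebra.proj_of_mem_ne (der_mem hf hx) (by omega), map_zero]
  have key : V.IsLieSubalgebraOver (V.freeLieSub ⊓ V.freeLieSub.comap (V.der f)) := by
    refine ⟨?_, ?_, fun w => ⟨hF.ι_mem w, ?_⟩⟩
    · rintro x ⟨hx, hx'⟩ n
      refine ⟨hF.graded x hx n, ?_⟩
      have := hF.graded _ hx' (n + 1)
      exact (congrArg (· ∈ V.freeLieSub) (hcomp x n)).mpr this
    · rintro x ⟨hx, hx'⟩ y ⟨hy, hy'⟩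
      refine ⟨hF.comm_mem x hx y hy, ?_⟩
      change V.der f (V.comm x y) ∈ V.freeLieSub
      rw [der_comm_parity hf]
      exact add_mem (hF.comm_mem _ hx' _ hy) (hF.comm_mem _ (V.parity_mem_freeLieSub hx) _ hy')
    · simpa using hL w
  exact (freeLieSub_le key ha).2

end GrMod

/-! ### Graded coalgebras and the cobar construction -/

/-- The component of degree `n` of `V ⊗ V`. -/
def GrMod.tensorGr {K : Type u} [Field K] (V : GrMod.{u, v} K) (n : ℤ) :
    Submodule K (V ⊗[K] V) :=
  Submodule.span K {t | ∃ i j : ℤ, i + j = n ∧ ∃ x ∈ V.gr i, ∃ y ∈ V.gr j, t = x ⊗ₜ[K] y}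

/-- A (not necessarily counital) coassociative graded coalgebra over `K`. -/
structure GrCoalg (K : Type u) [Field K] extends GrMod.{u, v} K where
  Δ : carrier →ₗ[K] carrier ⊗[K] carrier
  Δ_mem : ∀ {n : ℤ} {x : carrier}, x ∈ gr n → Δ x ∈ toGrMod.tensorGr n
  coassoc : (TensorProduct.assoc K carrier carrier carrier).toLinearMap ∘ₗ
    Δ.rTensor carrier ∘ₗ Δ = Δ.lTensor carrier ∘ₗ Δ

namespace GrCoalg

variable {K : Type u} [Field K] (C : GrCoalg.{u, v} K)

instance : CoeSort (GrCoalg.{u, v} K) (Type v) := ⟨fun C => C.carrier⟩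

/-- The twist map `x ⊗ y ↦ (-1) ^ (deg x * deg y) y ⊗ x`. -/
def twist : C ⊗[K] C →ₗ[K] C ⊗[K] C :=
  TensorProduct.lift (C.koszulFlip (TensorProduct.mk K C C))

theorem twist_tmul {i j : ℤ} {x y : C} (hx : x ∈ C.gr i) (hy : y ∈ C.gr j) :
    C.twist (x ⊗ₜ y) = (((i * j).negOnePow : ℤˣ) : ℤ) • (y ⊗ₜ[K] x) := by
  rw [twist, TensorProduct.lift.tmul, C.koszulFlip_of_mem _ hx hy, TensorProduct.mk_apply]

/-- Graded cocommutativity. -/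
def IsCocommutative : Prop := C.twist ∘ₗ C.Δ = C.Δ

/-- `C.pow n` is `C^{⊗ (n + 1)}`, with the parentheses to the right. -/
def pow : ℕ → ModuleCat.{v} K
  | 0 => ModuleCat.of K C
  | n + 1 => ModuleCat.of K (C ⊗[K] pow n)

/-- The iterated coproduct `Δⁿ : C → C^{⊗ (n + 1)}`, with `Δ⁰ = id` and
`Δⁿ⁺¹ = (id ⊗ Δⁿ) Δ`. -/
def iterΔ : (n : ℕ) → C →ₗ[K] C.pow n
  | 0 => LinearMap.id
  | n + 1 => (iterΔ n).lTensor C ∘ₗ C.Δ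

/-- `C` is locally conilpotent if it is the union of the kernels of the iterated coproducts. -/
def IsLocallyConilpotent : Prop := ∀ x : C, ∃ n : ℕ, C.iterΔ n x = 0

/-- The suspension `s : C → C[-1]`. -/
def susp : C ≃ₗ[K] C.shift := LinearEquiv.refl K C

theorem susp_mem {i : ℤ} {x : C} (hx : x ∈ C.gr i) : C.susp x ∈ C.shift.gr (i + 1) := by
  change x ∈ C.gr (i + 1 - 1)
  rwa [add_sub_cancel_right]

/-- The linear map `C ⊗ C → T(C[-1])`, `x ⊗ y ↦ (-1) ^ (deg x) s x ⊗ s y`. -/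
def cobarMul : C ⊗[K] C →ₗ[K] TensorAlgebra K C.shift :=
  TensorProduct.lift ((LinearMap.mul K (TensorAlgebra K C.shift)).compl₁₂
    (TensorAlgebra.ι K ∘ₗ C.susp.toLinearMap ∘ₗ C.sgn 1)
    (TensorAlgebra.ι K ∘ₗ C.susp.toLinearMap))

theorem cobarMul_tmul {i : ℤ} {x : C} (hx : x ∈ C.gr i) (y : C) :
    C.cobarMul (x ⊗ₜ y) = ((i.negOnePow : ℤˣ) : ℤ) •
      (TensorAlgebra.ι K (C.susp x) * TensorAlgebra.ι K (C.susp y)) := by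
  rw [cobarMul, TensorProduct.lift.tmul, LinearMap.compl₁₂_apply, LinearMap.comp_apply,
    LinearMap.comp_apply, C.sgn_of_mem 1 hx, one_mul, map_zsmul, map_zsmul, LinearMap.mul_apply',
    smul_mul_assoc]
  rfl

/-- The differential of the cobar construction on generators: if `Δ x = ∑ xᵢ ⊗ xᵢ'` then
`d (s x) = ∑ (-1) ^ (deg xᵢ) s xᵢ ⊗ s xᵢ'`. -/
def cobarGen : C.shift →ₗ[K] TensorAlgebra K C.shift :=
  C.cobarMul ∘ₗ C.Δ ∘ₗ C.susp.symm.toLinearMap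

theorem cobarGen_isDegreeOne : C.shift.IsDegreeOne C.cobarGen := by
  intro i w hw
  have h := C.Δ_mem (x := C.susp.symm w) hw
  change C.cobarMul (C.Δ (C.susp.symm w)) ∈ _
  generalize C.Δ (C.susp.symm w) = t at h ⊢
  induction h using Submodule.span_induction with
  | mem t ht =>
    obtain ⟨p, q, hpq, x, hx, y, hy, rfl⟩ := ht
    rw [C.cobarMul_tmul hx]
    refine zsmul_mem ?_ _
    have := C.shift.mul_mem_gr (GrMod.ι_mem (C.susp_mem hx)) (GrMod.ι_mem (C.susp_mem hy))
    rwa [show p + 1 + (q + 1) = i + 1 by omega] at this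
  | zero => simp
  | add s t _ _ hs ht => rw [map_add]; exact add_mem hs ht
  | smul r t _ ht => rw [map_smul]; exact Submodule.smul_mem _ r ht

/-- The differential of `T(C[-1])`. -/
def cobarD : TensorAlgebra K C.shift →ₗ[K] TensorAlgebra K C.shift :=
  C.shift.der C.cobarGen

/-- The bilinear expression `x ⊗ y ↦ (-1) ^ (deg x) [s x, s y]`. -/
def cobarBracket : C ⊗[K] C →ₗ[K] TensorAlgebra K C.shift :=
  TensorProduct.lift (C.shift.comm.compl₁₂
    (TensorAlgebra.ι K ∘ₗ C.susp.toLinearMap ∘ₗ C.sgn 1)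
    (TensorAlgebra.ι K ∘ₗ C.susp.toLinearMap))

theorem cobarBracket_tmul {i : ℤ} {x : C} (hx : x ∈ C.gr i) (y : C) :
    C.cobarBracket (x ⊗ₜ y) = ((i.negOnePow : ℤˣ) : ℤ) •
      C.shift.comm (TensorAlgebra.ι K (C.susp x)) (TensorAlgebra.ι K (C.susp y)) := by
  rw [cobarBracket, TensorProduct.lift.tmul, LinearMap.compl₁₂_apply, LinearMap.comp_apply,
    LinearMap.comp_apply, C.sgn_of_mem 1 hx, one_mul, map_zsmul, map_zsmul, map_zsmul]
  rfl

theorem tensor_hom_ext {W : Type*} [AddCommMonoid W] [Module K W] {f g : C ⊗[K] C →ₗ[K] W}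
    (h : ∀ i j, ∀ x ∈ C.gr i, ∀ y ∈ C.gr j, f (x ⊗ₜ y) = g (x ⊗ₜ y)) : f = g := by
  apply TensorProduct.ext
  refine C.hom_ext fun i x hx => C.hom_ext fun j y hy => ?_
  exact h i j x hx y hy

theorem cobarBracket_eq : C.cobarBracket = C.cobarMul + C.cobarMul ∘ₗ C.twist := by
  refine C.tensor_hom_ext fun i j x hx y hy => ?_
  rw [C.cobarBracket_tmul hx, LinearMap.add_apply, LinearMap.comp_apply, C.twist_tmul hx hy,
    map_zsmul, C.cobarMul_tmul hx, C.cobarMul_tmul hy,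
    C.shift.comm_of_mem (GrMod.ι_mem (C.susp_mem hx)) (GrMod.ι_mem (C.susp_mem hy))]
  simp only [mul_add, add_mul, Int.negOnePow_add, mul_one, one_mul]
  rcases Int.units_eq_one_or (i * j).negOnePow with h | h <;>
  rcases Int.units_eq_one_or i.negOnePow with h' | h' <;>
  rcases Int.units_eq_one_or j.negOnePow with h'' | h'' <;>
  simp only [h, h', h'', mul_one, Units.val_one, Units.val_neg, one_smul, neg_smul,
    mul_neg, neg_neg, Int.negOnePow_one] <;>
  abel

/-- `d (s x) = 1/2 ∑ (-1) ^ (deg xᵢ) [s xᵢ, s xᵢ']` if `C` is cocommutative. -/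
theorem cobarGen_eq [CharZero K] (hC : C.IsCocommutative) (x : C) :
    C.cobarGen (C.susp x) = (2⁻¹ : K) • C.cobarBracket (C.Δ x) := by
  have h : C.twist (C.Δ x) = C.Δ x := LinearMap.congr_fun hC x
  rw [cobarBracket_eq, LinearMap.add_apply, LinearMap.comp_apply, h, ← two_smul K, smul_smul,
    inv_mul_cancel₀ two_ne_zero, one_smul]
  rfl

theorem cobarGen_mem [CharZero K] (hC : C.IsCocommutative) (w : C.shift) :
    C.cobarGen w ∈ C.shift.freeLieSub := by
  have h := C.cobarGen_eq hC (C.susp.symm w)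
  rw [LinearEquiv.apply_symm_apply] at h
  rw [h]
  refine Submodule.smul_mem _ _ ?_
  have hF := C.shift.isLieSubalgebraOver_freeLieSub
  generalize C.Δ (C.susp.symm w) = t
  induction t using TensorProduct.induction_on with
  | zero => simp
  | add s t hs ht => rw [map_add]; exact add_mem hs ht
  | tmul x y =>
    exact hF.comm_mem _ (hF.ι_mem _) _ (hF.ι_mem _)

/-- The trilinear expression `x ⊗ y ⊗ z ↦ (-1) ^ (deg y) s x ⊗ s y ⊗ s z`. -/
def cobarMul₃ : C ⊗[K] (C ⊗[K] C) →ₗ[K] TensorAlgebra K C.shift :=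
  TensorProduct.lift ((LinearMap.mul K (TensorAlgebra K C.shift)).compl₁₂
    (TensorAlgebra.ι K ∘ₗ C.susp.toLinearMap) C.cobarMul)

theorem cobarMul₃_tmul (x : C) (t : C ⊗[K] C) :
    C.cobarMul₃ (x ⊗ₜ t) = TensorAlgebra.ι K (C.susp x) * C.cobarMul t := rfl

theorem cobarMul₃_assoc {i : ℤ} {t : C ⊗[K] C} (ht : t ∈ C.tensorGr i) (z : C) :
    C.cobarMul₃ (TensorProduct.assoc K C C C (t ⊗ₜ z)) =
      ((i.negOnePow : ℤˣ) : ℤ) • (C.cobarMul t * TensorAlgebra.ι K (C.susp z)) := by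
  induction ht using Submodule.span_induction with
  | mem t ht =>
    obtain ⟨p, q, rfl, x, hx, y, hy, rfl⟩ := ht
    rw [TensorProduct.assoc_tmul, cobarMul₃_tmul, C.cobarMul_tmul hx, C.cobarMul_tmul hy,
      mul_smul_comm, smul_mul_assoc, smul_smul, Int.negOnePow_add, mul_assoc]
    congr 1
    rcases Int.units_eq_one_or p.negOnePow with h | h <;> simp [h]
  | zero => simp
  | add s t _ _ hs ht => rw [TensorProduct.add_tmul, map_add, map_add, hs, ht, map_add, add_mul,
      smul_add]
  | smul r t _ ht => rw [← TensorProduct.smul_tmul', map_smul, map_smul, ht, map_smul,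
      smul_mul_assoc, smul_comm]

theorem cobarD_comp_cobarMul : C.cobarD ∘ₗ C.cobarMul =
    C.cobarMul₃ ∘ₗ (TensorProduct.assoc K C C C).toLinearMap ∘ₗ C.Δ.rTensor C -
      C.cobarMul₃ ∘ₗ C.Δ.lTensor C := by
  refine C.tensor_hom_ext fun i j x hx y hy => ?_
  simp only [LinearMap.comp_apply, LinearMap.sub_apply, LinearMap.rTensor_tmul,
    LinearMap.lTensor_tmul, LinearEquiv.coe_coe]
  rw [C.cobarMul₃_assoc (C.Δ_mem hx), cobarMul₃_tmul, C.cobarMul_tmul hx, map_zsmul, cobarD,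
    C.shift.der_mul _ (GrMod.ι_mem (C.susp_mem hx)), GrMod.der_ι, GrMod.der_ι, smul_add,
    Int.negOnePow_succ, smul_smul, sub_eq_add_neg]
  congr 1
  have : ((i.negOnePow : ℤˣ) : ℤ) * ((-i.negOnePow : ℤˣ) : ℤ) = -1 := by
    rcases Int.units_eq_one_or i.negOnePow with h | h <;> simp [h]
  rw [this, neg_one_smul]
  rfl

theorem cobarD_cobarGen (w : C.shift) : C.cobarD (C.cobarGen w) = 0 := by
  have h := LinearMap.congr_fun C.cobarD_comp_cobarMul (C.Δ (C.susp.symm w))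
  have h' := LinearMap.congr_fun C.coassoc (C.susp.symm w)
  simp only [LinearMap.comp_apply, LinearMap.sub_apply, LinearEquiv.coe_coe] at h h'
  rw [h', sub_self] at h
  exact h

/-- The cobar construction of a cocommutative graded coalgebra `C`: the free graded Lie algebra
`𝕃(C[-1])` with the restriction of the differential of `T(C[-1])`. -/
def cobar [CharZero K] (C : GrCoalg.{u, v} K) (hC : C.IsCocommutative) :
    DGLie.{u, max u v} K where
  toGrLie := freeLie C.shift
  d := C.cobarD.restrict fun _ ha =>
    GrMod.der_mem_freeLieSub C.cobarGen_isDegreeOne (C.cobarGen_mem hC) ha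
  d_mem hx := GrMod.der_mem C.cobarGen_isDegreeOne hx
  d_d x := Subtype.ext (GrMod.der_der C.cobarGen_isDegreeOne C.cobarD_cobarGen x.1)
  leibniz hx hy := Subtype.ext (GrMod.der_comm C.cobarGen_isDegreeOne hx hy)

end GrCoalg

/-! ### Semifree extensions -/

section Semifree

variable {K : Type u} [Field K]

/-- A morphism `f : A → B` of DG-Lie algebras is an elementary semifree extension if, as a
morphism of graded Lie algebras, it is the inclusion `A → A ⨿ 𝕃(V)` in the coproduct of graded Lie
algebras for a graded vector space `V`, and `d V ⊆ A`. -/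
def elementarySemifree (K : Type u) [Field K] : MorphismProperty (DGLie.{u, max u v} K) :=
  fun _ B f => ∃ (V : GrMod.{u, max u v} K) (j : freeLie V ⟶ B.toGrLie),
    Nonempty (Limits.IsColimit (Limits.BinaryCofan.mk (DGLie.grHom f) j)) ∧
    ∀ w : V, B.d (j.toLinearMap (freeLie.ι V w)) ∈ LinearMap.range f.toLinearMap

/-- A semifree extension is a countable composition of elementary semifree extensions: the
morphism from the first term to the colimit of a sequence `A₀ → A₁ → A₂ → ⋯`. -/
def semifreeExtension (K : Type u) [Field K] : MorphismProperty (DGLie.{u, max u v} K) :=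
  (elementarySemifree.{u, v} K).transfiniteCompositionsOfShape ℕ

/-- The zero DG-Lie algebra. -/
def DGLie.zero (K : Type u) [Field K] : DGLie.{u, v} K where
  carrier := PUnit
  gr _ := ⊥
  internal := by
    rw [DirectSum.isInternal_submodule_iff_iSupIndep_and_iSup_eq_top]
    exact ⟨fun _ => disjoint_bot_left, Subsingleton.elim _ _⟩
  bracket := 0
  bracket_mem _ _ := rfl
  skew _ _ := rfl
  jacobi _ _ _ := rfl
  d := 0
  d_mem _ := rfl
  d_d _ := rfl
  leibniz _ _ := rfl

/-- The initial map `0 → L`. -/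
def DGLie.initialMap (L : DGLie.{u, v} K) : DGLie.zero.{u, v} K ⟶ L :=
  DGLie.Hom.mk ⟨0, fun _ => Submodule.zero_mem _, fun _ _ => by simp⟩ fun _ => by simp

/-- `L` is semifree if `0 → L` is a semifree extension. -/
def DGLie.IsSemifree (L : DGLie.{u, max u v} K) : Prop :=
  semifreeExtension.{u, v} K L.initialMap

end Semifree

end DGLieCobar

end

-- Filter the generators by `D n = s (ker Δⁿ)`. Since `Δ⁰ = id`, the filtration starts at `0`; local
-- conilpotency says that it exhausts `C[-1]`. If `Δⁿ⁺¹ x = 0`, then `(id ⊗ Δⁿ) (Δ x) = 0`, so over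
-- a field `Δ x` lies in `C ⊗ ker Δⁿ`. Cocommutativity puts it in `ker Δⁿ ⊗ C` as well, hence in
-- `ker Δⁿ ⊗ ker Δⁿ` (`Δ_mem_map₂_ker_iterΔ`). The formula `d (s x) = 1/2 ∑ ± [s xᵢ, s xᵢ']` then
-- shows that `d` maps `D (n + 1)` into the Lie subalgebra generated by `D n` (`cobar_d_mem`).
--
-- It remains to see that such a filtration makes a free Lie algebra semifree
-- (`DGLie.isSemifree_of_filtration`). The stages are the subalgebras generated by the `D n`. They
-- are stable under `d`, and their union is everything. Each inclusion of consecutive stages is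
-- elementary: a graded complement of `D n` in `D (n + 1)` generates the free factor, and the
-- coproduct property of the larger stage follows from freeness of the whole algebra
-- (`elementarySemifree_subDGInclusion`).
--
-- Freeness itself has to be extracted from the definition of `𝕃(V)` as a subspace of `T(V)`. In
-- characteristic zero this is the Dynkin–Specht–Wever argument: on a Lie element of length `n`,
-- replacing tensors by right-normed brackets multiplies by `n`. Dividing by `n` gives a map defined
-- on all of `T(V)` whose restriction to `𝕃(V)` is the required morphism (`freeLie.lift`).

universe w

noncomputable section

namespace DGLieCobar

open CategoryTheory TensorProduct

/-! ### The universal property of the free graded Lie algebra -/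

section Lift

variable {K : Type u} [Field K] {V : GrMod.{u, v} K} {L : GrLie.{u, max u v} K}

/-- The adjoint action of `T(V)` on `L` induced by a linear map `V → L`. -/
def adjAction (φ : V →ₗ[K] L) : TensorAlgebra K V →ₐ[K] Module.End K L :=
  TensorAlgebra.lift K (L.bracket ∘ₗ φ)

theorem adjAction_ι (φ : V →ₗ[K] L) (x : V) :
    adjAction φ (TensorAlgebra.ι K x) = L.bracket (φ x) := by
  rw [adjAction, TensorAlgebra.lift_ι_apply]; rfl

/-- The action of `T(V)` on `L × K` with `v • (l, c) = ([φ v, l] + c φ v, 0)`. -/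
def affAction (φ : V →ₗ[K] L) : TensorAlgebra K V →ₐ[K] Module.End K (L × K) :=
  TensorAlgebra.lift K (LinearMap.mk₂ K
    (fun x p => (L.bracket (φ x) p.1 + p.2 • φ x, (0 : K)))
    (fun x y p => by ext <;> simp; abel)
    (fun r x p => by ext <;> simp [smul_comm p.2 r])
    (fun x p q => by ext <;> simp [add_smul]; abel)
    (fun r x p => by ext <;> simp [mul_smul]))

theorem affAction_ι (φ : V →ₗ[K] L) (x : V) (p : L × K) :
    affAction φ (TensorAlgebra.ι K x) p = (L.bracket (φ x) p.1 + p.2 • φ x, 0) := by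
  rw [affAction, TensorAlgebra.lift_ι_apply]; rfl

/-- The scalar coordinate only serves to start a right-normed bracket: it turns the last letter `v`
into `φ v`. Once it is zero, every further letter acts by bracketing. -/
theorem affAction_left (φ : V →ₗ[K] L) (a : TensorAlgebra K V) (l : L) :
    affAction φ a (l, 0) = (adjAction φ a l, 0) := by
  induction a using TensorAlgebra.induction generalizing l with
  | algebraMap r => simp [Module.algebraMap_end_apply]
  | ι x => rw [affAction_ι, adjAction_ι]; simp
  | mul a b ha hb => simp [ha, hb]
  | add a b ha hb => simp [ha, hb]

/-- The linear map `v₁ ⊗ ⋯ ⊗ vₙ ↦ [φ v₁, [φ v₂, …, φ vₙ]]`. -/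
def rightNorm (φ : V →ₗ[K] L) : TensorAlgebra K V →ₗ[K] L :=
  LinearMap.fst K L K ∘ₗ LinearMap.applyₗ (0, 1) ∘ₗ (affAction φ).toLinearMap

theorem rightNorm_apply (φ : V →ₗ[K] L) (a : TensorAlgebra K V) :
    rightNorm φ a = (affAction φ a (0, 1)).1 := rfl

/-- The map `n⁻¹ • rightNorm φ` on tensors of length `n`. -/
def dynkin (φ : V →ₗ[K] L) : TensorAlgebra K V →ₗ[K] L :=
  DirectSum.toModule K ℕ L (fun n => (n : K)⁻¹ • (rightNorm φ ∘ₗ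
    ((LinearMap.range (TensorAlgebra.ι K : V →ₗ[K] TensorAlgebra K V)) ^ n).subtype)) ∘ₗ
  (DirectSum.decomposeLinearEquiv fun n : ℕ =>
    (LinearMap.range (TensorAlgebra.ι K : V →ₗ[K] TensorAlgebra K V)) ^ n).toLinearMap

theorem dynkin_of_mem (φ : V →ₗ[K] L) {n : ℕ} {a : TensorAlgebra K V}
    (ha : a ∈ (LinearMap.range (TensorAlgebra.ι K : V →ₗ[K] TensorAlgebra K V)) ^ n) :
    dynkin φ a = (n : K)⁻¹ • rightNorm φ a := by
  have := DirectSum.decompose_of_mem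
    (fun n : ℕ => (LinearMap.range (TensorAlgebra.ι K : V →ₗ[K] TensorAlgebra K V)) ^ n) ha
  simp only [dynkin, LinearMap.comp_apply, LinearEquiv.coe_coe,
    DirectSum.decomposeLinearEquiv_apply, this]
  exact DirectSum.toModule_lof K n _

/-- `IsLieMonomial φ n i a l` says that `a` is an iterated commutator of `n` homogeneous elements
of `V`, of total degree `i`, and that `l` is the same iterated bracket of their images in `L`. -/
inductive IsLieMonomial (φ : V →ₗ[K] L) : ℕ → ℤ → TensorAlgebra K V → L → Prop
  | ι {i : ℤ} {x : V} (hx : x ∈ V.gr i) : IsLieMonomial φ 1 i (TensorAlgebra.ι K x) (φ x)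
  | comm {m n : ℕ} {i j : ℤ} {a b : TensorAlgebra K V} {k l : L}
      (ha : IsLieMonomial φ m i a k) (hb : IsLieMonomial φ n j b l) :
      IsLieMonomial φ (m + n) (i + j) (V.comm a b) (L.bracket k l)

/-! ### The Dynkin–Specht–Wever identity on Lie monomials. -/

namespace IsLieMonomial

variable {φ : V →ₗ[K] L} {n : ℕ} {i : ℤ} {a : TensorAlgebra K V} {l : L}

theorem pos (h : IsLieMonomial φ n i a l) : 0 < n := by
  induction h with
  | ι => exact one_pos
  | comm _ _ h => omega

theorem mem_gr (h : IsLieMonomial φ n i a l) : a ∈ V.tensorAlgebraGr i := by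
  induction h with
  | ι hx => exact GrMod.ι_mem hx
  | comm _ _ ha hb => exact V.comm_mem ha hb

theorem image_mem_gr (hφ : ∀ i, ∀ x ∈ V.gr i, φ x ∈ L.gr i) (h : IsLieMonomial φ n i a l) :
    l ∈ L.gr i := by
  induction h with
  | ι hx => exact hφ _ _ hx
  | comm _ _ ha hb => exact L.bracket_mem ha hb

theorem mem_pow (h : IsLieMonomial φ n i a l) :
    a ∈ (LinearMap.range (TensorAlgebra.ι K : V →ₗ[K] TensorAlgebra K V)) ^ n := by
  induction h with
  | ι hx => rw [pow_one]; exact LinearMap.mem_range_self _ _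
  | comm ha hb iha ihb =>
    rw [V.comm_of_mem ha.mem_gr hb.mem_gr]
    refine sub_mem ?_ (zsmul_mem ?_ _)
    · rw [pow_add]; exact Submodule.mul_mem_mul iha ihb
    · rw [add_comm, pow_add]; exact Submodule.mul_mem_mul ihb iha

/-- By the graded Jacobi identity, the bracket with `[k, l]` is the graded commutator of the
brackets with `k` and `l`, so the identity passes from letters to iterated commutators. -/
theorem adjAction_eq (hφ : ∀ i, ∀ x ∈ V.gr i, φ x ∈ L.gr i) (h : IsLieMonomial φ n i a l) :
    adjAction φ a = L.bracket l := by
  induction h with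
  | ι hx => exact adjAction_ι _ _
  | @comm m n i j a b k l ha hb iha ihb =>
    rw [V.comm_of_mem ha.mem_gr hb.mem_gr, map_sub, map_zsmul, map_mul, map_mul, iha, ihb]
    refine L.hom_ext fun p z hz => ?_
    have := L.jacobi (ha.image_mem_gr hφ) (hb.image_mem_gr hφ) hz
    simp only [LinearMap.sub_apply, LinearMap.smul_apply, Module.End.mul_apply]
    rw [this, add_sub_cancel_right]

/-- This is the Dynkin–Specht–Wever count. For a commutator of monomials of lengths `m` and `n` with
images `k` and `l`, the product `a b` contributes `n [k, l]`, while `b a` with its sign contributes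
`m [k, l]`. -/
theorem affAction_eq (hφ : ∀ i, ∀ x ∈ V.gr i, φ x ∈ L.gr i) (h : IsLieMonomial φ n i a l) :
    affAction φ a (0, 1) = (n • l, 0) := by
  induction h with
  | ι hx => rw [affAction_ι]; simp
  | @comm m n i j a b k l ha hb iha ihb =>
    -- Skew symmetry absorbs the Koszul sign of the commutator, so that the two contributions add up
    -- instead of cancelling.
    have e : (((i * j).negOnePow : ℤˣ) : ℤ) • L.bracket l k = -L.bracket k l := by
      rw [L.skew (ha.image_mem_gr hφ) (hb.image_mem_gr hφ), neg_neg]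
    rw [V.comm_of_mem ha.mem_gr hb.mem_gr, map_sub, map_zsmul, map_mul, map_mul,
      LinearMap.sub_apply, LinearMap.smul_apply, Module.End.mul_apply, Module.End.mul_apply,
      iha, ihb, affAction_left, affAction_left, ha.adjAction_eq hφ, hb.adjAction_eq hφ]
    ext
    · simp only [Prod.fst_sub, Prod.smul_fst, map_nsmul]
      rw [smul_comm _ m, e, add_smul, smul_neg, sub_neg_eq_add, add_comm]
    · simp

/-- The length is positive, hence invertible in characteristic zero. Since the left side depends on
`a` alone, so does `l`: bracket expressions that agree in `T(V)` have the same image in `L`. -/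
theorem dynkin_eq [CharZero K] (hφ : ∀ i, ∀ x ∈ V.gr i, φ x ∈ L.gr i)
    (h : IsLieMonomial φ n i a l) : dynkin φ a = l := by
  rw [dynkin_of_mem φ h.mem_pow, rightNorm_apply, h.affAction_eq hφ, ← Nat.cast_smul_eq_nsmul K,
    smul_smul, inv_mul_cancel₀ (Nat.cast_ne_zero.2 h.pos.ne'), one_smul]

end IsLieMonomial

/-- The span is itself a graded Lie subalgebra containing `V`, so minimality of `𝕃(V)` applies.
Identities on `𝕃(V)` that are linear in each argument can therefore be checked on Lie monomials. -/
theorem freeLieSub_le_span_isLieMonomial (φ : V →ₗ[K] L) :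
    V.freeLieSub ≤ Submodule.span K {a | ∃ n i l, IsLieMonomial φ n i a l} := by
  refine GrMod.freeLieSub_le ⟨fun x hx n => ?_, fun a ha b hb => ?_, fun x => ?_⟩
  · induction hx using Submodule.span_induction with
    | mem x h =>
      obtain ⟨m, i, l, h⟩ := h
      by_cases hi : i = n
      · subst hi
        rw [V.tensorAlgebra.proj_of_mem h.mem_gr]
        exact Submodule.subset_span ⟨m, i, l, h⟩
      · rw [V.tensorAlgebra.proj_of_mem_ne h.mem_gr hi]
        exact Submodule.zero_mem _
    | zero => rw [map_zero]; exact Submodule.zero_mem _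
    | add x y _ _ hx hy =>
      have : V.tensorAlgebra.proj n (x + y) = _ := map_add _ _ _
      rw [this]; exact add_mem hx hy
    | smul r x _ hx =>
      have : V.tensorAlgebra.proj n (r • x) = _ := map_smul _ _ _
      rw [this]; exact Submodule.smul_mem _ r hx
  · have := Submodule.apply_mem_map₂ V.comm ha hb
    rw [Submodule.map₂_span_span] at this
    refine Submodule.span_mono ?_ this
    rintro _ ⟨a, ⟨m, i, k, ha⟩, b, ⟨n, j, l, hb⟩, rfl⟩
    exact ⟨_, _, _, ha.comm hb⟩
  · induction x using V.induction with
    | h0 => rw [map_zero]; exact Submodule.zero_mem _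
    | hom i x hx => exact Submodule.subset_span ⟨_, _, _, .ι hx⟩
    | hadd x y hx hy => rw [map_add]; exact add_mem hx hy

theorem dynkin_comm [CharZero K] {φ : V →ₗ[K] L} (hφ : ∀ i, ∀ x ∈ V.gr i, φ x ∈ L.gr i)
    {a b : TensorAlgebra K V} (ha : a ∈ V.freeLieSub) (hb : b ∈ V.freeLieSub) :
    dynkin φ (V.comm a b) = L.bracket (dynkin φ a) (dynkin φ b) := by
  replace ha := freeLieSub_le_span_isLieMonomial φ ha
  replace hb := freeLieSub_le_span_isLieMonomial φ hb
  induction ha, hb using Submodule.span_induction₂ with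
  | mem_mem a b ha hb =>
    obtain ⟨m, i, k, ha⟩ := ha
    obtain ⟨n, j, l, hb⟩ := hb
    rw [(ha.comm hb).dynkin_eq hφ, ha.dynkin_eq hφ, hb.dynkin_eq hφ]
  | zero_left => simp
  | zero_right => simp
  | add_left x y z _ _ _ hx hy => simp only [map_add, LinearMap.add_apply, hx, hy]
  | add_right x y z _ _ _ hx hy => simp only [map_add, hx, hy]
  | smul_left r x y _ _ h => simp only [map_smul, LinearMap.smul_apply, h]
  | smul_right r x y _ _ h => simp only [map_smul, h]

theorem dynkin_proj [CharZero K] {φ : V →ₗ[K] L} (hφ : ∀ i, ∀ x ∈ V.gr i, φ x ∈ L.gr i)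
    {a : TensorAlgebra K V} (ha : a ∈ V.freeLieSub) (n : ℤ) :
    dynkin φ (V.tensorAlgebra.proj n a) = L.proj n (dynkin φ a) := by
  have ha := freeLieSub_le_span_isLieMonomial φ ha
  suffices h : Set.EqOn (dynkin φ ∘ₗ V.tensorAlgebra.proj n) (L.proj n ∘ₗ dynkin φ)
      {a | ∃ n i l, IsLieMonomial φ n i a l} from LinearMap.eqOn_span h ha
  rintro a ⟨m, i, l, h⟩
  simp only [LinearMap.comp_apply]
  by_cases hi : i = n
  · subst hi
    rw [V.tensorAlgebra.proj_of_mem h.mem_gr, h.dynkin_eq hφ, L.proj_of_mem (h.image_mem_gr hφ)]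
  · rw [V.tensorAlgebra.proj_of_mem_ne h.mem_gr hi, h.dynkin_eq hφ,
      L.proj_of_mem_ne (h.image_mem_gr hφ) hi, map_zero]

/-- The morphism of graded Lie algebras `𝕃(V) → L` extending a linear map `V → L` of
degree `0`. -/
def freeLie.lift [CharZero K] (φ : V →ₗ[K] L) (hφ : ∀ i, ∀ x ∈ V.gr i, φ x ∈ L.gr i) :
    GrLie.Hom (freeLie V) L where
  toLinearMap := dynkin φ ∘ₗ V.freeLieSub.subtype
  map_gr {i x} hx := by
    have h := dynkin_proj hφ x.2 i
    have h' : V.tensorAlgebra.proj i x.1 = x.1 := V.tensorAlgebra.proj_of_mem hx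
    change dynkin φ x.1 ∈ _
    rw [(congrArg (dynkin φ) h').symm.trans h]
    exact L.proj_mem i _
  map_bracket x y := dynkin_comm hφ x.2 y.2

theorem freeLie.lift_ι [CharZero K] (φ : V →ₗ[K] L) (hφ : ∀ i, ∀ x ∈ V.gr i, φ x ∈ L.gr i)
    (x : V) : (freeLie.lift φ hφ).toLinearMap (freeLie.ι V x) = φ x := by
  change dynkin φ (TensorAlgebra.ι K x) = φ x
  induction x using V.induction with
  | h0 => simp
  | hom i x hx => exact (IsLieMonomial.ι hx).dynkin_eq hφ
  | hadd x y hx hy => rw [map_add, map_add, map_add, hx, hy]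

end Lift

/-! ### Graded Lie subalgebras -/

namespace GrMod

variable {K : Type u} [Field K]

theorem map_proj {V : GrMod.{u, v} K} {W : GrMod.{u, w} K} {f : V →ₗ[K] W} {k : ℤ}
    (hf : ∀ i, ∀ x ∈ V.gr i, f x ∈ W.gr (i + k)) (n : ℤ) (x : V) :
    f (V.proj n x) = W.proj (n + k) (f x) := by
  suffices h : f ∘ₗ V.proj n = W.proj (n + k) ∘ₗ f from LinearMap.congr_fun h x
  refine V.hom_ext fun i x hx => ?_
  simp only [LinearMap.comp_apply]
  by_cases h : i = n
  · subst h
    rw [V.proj_of_mem hx, W.proj_of_mem (hf i x hx)]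
  · rw [V.proj_of_mem_ne hx h, W.proj_of_mem_ne (hf i x hx) (by omega), map_zero]

theorem map_proj_zero {V : GrMod.{u, v} K} {W : GrMod.{u, w} K} {f : V →ₗ[K] W}
    (hf : ∀ i, ∀ x ∈ V.gr i, f x ∈ W.gr i) (n : ℤ) (x : V) :
    f (V.proj n x) = W.proj n (f x) := by
  simpa using map_proj (k := 0) (by simpa using hf) n x

theorem IsGraded.map_of_degree {V : GrMod.{u, v} K} {W : GrMod.{u, w} K} {f : V →ₗ[K] W} {k : ℤ}
    (hf : ∀ i, ∀ x ∈ V.gr i, f x ∈ W.gr (i + k)) {S : Submodule K V} (hS : V.IsGraded S) :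
    W.IsGraded (S.map f) := by
  rintro _ ⟨x, hx, rfl⟩ n
  rw [← sub_add_cancel n k, ← map_proj hf]
  exact Submodule.mem_map_of_mem (hS x hx _)

theorem IsGraded.map {V : GrMod.{u, v} K} {W : GrMod.{u, w} K} {f : V →ₗ[K] W}
    (hf : ∀ i, ∀ x ∈ V.gr i, f x ∈ W.gr i) {S : Submodule K V} (hS : V.IsGraded S) :
    W.IsGraded (S.map f) :=
  hS.map_of_degree (k := 0) (by simpa using hf)

theorem IsGraded.sgn_mem {V : GrMod.{u, v} K} {S : Submodule K V} (hS : V.IsGraded S) (i : ℤ)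
    {x : V} (hx : x ∈ S) : V.sgn i x ∈ S := by
  obtain ⟨s, hs⟩ := V.exists_sum_proj x
  rw [← hs, map_sum]
  refine sum_mem fun j _ => ?_
  rw [V.sgn_of_mem i (V.proj_mem j x)]
  exact zsmul_mem (hS x hx j) _

theorem IsGraded.ker {V : GrMod.{u, v} K} {W : GrMod.{u, w} K} {f : V →ₗ[K] W}
    (hf : ∀ i, ∀ x ∈ V.gr i, f x ∈ W.gr i) : V.IsGraded (LinearMap.ker f) := by
  intro x hx n
  rw [LinearMap.mem_ker] at hx ⊢
  rw [map_proj_zero hf, hx, map_zero]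

theorem IsGraded.inf {V : GrMod.{u, v} K} {S T : Submodule K V} (hS : V.IsGraded S)
    (hT : V.IsGraded T) : V.IsGraded (S ⊓ T) :=
  fun x hx n => ⟨hS x hx.1 n, hT x hx.2 n⟩

/-- A graded subspace is the image of a projection of degree `0`. -/
theorem IsGraded.exists_projection {V : GrMod.{u, v} K} {S : Submodule K V} (hS : V.IsGraded S) :
    ∃ p : V →ₗ[K] V, (∀ i, ∀ x ∈ V.gr i, p x ∈ V.gr i) ∧ (∀ x, p x ∈ S) ∧ ∀ x ∈ S, p x = x := by
  have h : ∀ i, ∃ q : V.gr i →ₗ[K] S.comap (V.gr i).subtype,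
      q ∘ₗ (S.comap (V.gr i).subtype).subtype = LinearMap.id := fun i =>
    LinearMap.exists_leftInverse_of_injective _ (Submodule.ker_subtype _)
  choose q hq using h
  let p : V →ₗ[K] V :=
    V.desc fun i => (V.gr i).subtype ∘ₗ (S.comap (V.gr i).subtype).subtype ∘ₗ q i
  have hp : ∀ i x (hx : x ∈ V.gr i), p x = (q i ⟨x, hx⟩ : V.gr i) := fun i x hx =>
    V.desc_of_mem _ hx
  refine ⟨p, fun i x hx => ?_, fun x => ?_, fun x hx => ?_⟩
  · rw [hp i x hx]; exact (q i ⟨x, hx⟩ : V.gr i).2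
  · induction x using V.induction with
    | h0 => rw [map_zero]; exact S.zero_mem
    | hom i x hx => rw [hp i x hx]; exact (q i ⟨x, hx⟩).2
    | hadd x y hx hy => rw [map_add]; exact add_mem hx hy
  · obtain ⟨s, hs⟩ := V.exists_sum_proj x
    rw [← hs, map_sum]
    refine Finset.sum_congr rfl fun i _ => (hp i _ (V.proj_mem i x)).trans ?_
    have := LinearMap.congr_fun (hq i) ⟨⟨V.proj i x, V.proj_mem i x⟩, hS x hx i⟩
    exact congrArg (fun y : S.comap (V.gr i).subtype => ((y : V.gr i) : V)) this

end GrMod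

namespace GrLie

variable {K : Type u} [Field K]

/-- A graded Lie subalgebra. -/
structure IsLieSub (L : GrLie.{u, v} K) (S : Submodule K L) : Prop where
  graded : L.IsGraded S
  bracket_mem : ∀ a ∈ S, ∀ b ∈ S, L.bracket a b ∈ S

/-- The components of elements of a graded `S` stay in `S`, so bilinearity reduces closure to
homogeneous pairs, the only ones for which the Leibniz rule is stated. -/
theorem IsLieSub.of_homogeneous {L : GrLie.{u, v} K} {S : Submodule K L} (hS : L.IsGraded S)
    (h : ∀ i j, ∀ a ∈ S, ∀ b ∈ S, a ∈ L.gr i → b ∈ L.gr j → L.bracket a b ∈ S) :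
    L.IsLieSub S where
  graded := hS
  bracket_mem a ha b hb := by
    obtain ⟨s, hs⟩ := L.exists_sum_proj a
    obtain ⟨t, ht⟩ := L.exists_sum_proj b
    rw [← hs, ← ht, map_sum]
    refine sum_mem fun j _ => ?_
    rw [map_sum, LinearMap.sum_apply]
    exact sum_mem fun i _ => h i j _ (hS a ha i) _ (hS b hb j) (L.proj_mem _ _) (L.proj_mem _ _)

/-- The graded Lie subalgebra generated by a subspace. -/
def lieSpan (L : GrLie.{u, v} K) (X : Submodule K L) : Submodule K L :=
  sInf {S | L.IsLieSub S ∧ X ≤ S}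

variable {L M : GrLie.{u, v} K} {X Y S : Submodule K L}

theorem lieSpan_le (hS : L.IsLieSub S) (h : X ≤ S) : L.lieSpan X ≤ S :=
  sInf_le ⟨hS, h⟩

theorem le_lieSpan : X ≤ L.lieSpan X :=
  le_sInf fun _ h => h.2

theorem lieSpan_mono (h : X ≤ Y) : L.lieSpan X ≤ L.lieSpan Y :=
  le_sInf fun _ hS => lieSpan_le hS.1 (h.trans hS.2)

theorem isLieSub_lieSpan (L : GrLie.{u, v} K) (X : Submodule K L) :
    L.IsLieSub (L.lieSpan X) where
  graded x hx n := (Submodule.mem_sInf).2 fun S hS =>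
    hS.1.graded x ((Submodule.mem_sInf).1 hx S hS) n
  bracket_mem a ha b hb := (Submodule.mem_sInf).2 fun S hS =>
    hS.1.bracket_mem a ((Submodule.mem_sInf).1 ha S hS) b ((Submodule.mem_sInf).1 hb S hS)

/-- A graded Lie subalgebra, as a graded Lie algebra. -/
def subLie (L : GrLie.{u, v} K) (S : Submodule K L) (hS : L.IsLieSub S) : GrLie.{u, v} K where
  toGrMod := L.toGrMod.sub S hS.graded
  bracket := LinearMap.mk₂ K (fun a b => (⟨L.bracket a.1 b.1, hS.bracket_mem _ a.2 _ b.2⟩ : S))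
    (fun a b c => Subtype.ext (LinearMap.map_add₂ L.bracket a.1 b.1 c.1))
    (fun r a b => Subtype.ext (LinearMap.map_smul₂ L.bracket r a.1 b.1))
    (fun a b c => Subtype.ext (map_add (L.bracket a.1) b.1 c.1))
    (fun r a b => Subtype.ext (map_smul (L.bracket a.1) r b.1))
  bracket_mem hx hy := L.bracket_mem hx hy
  skew hx hy := Subtype.ext (L.skew hx hy)
  jacobi hx hy hz := Subtype.ext (L.jacobi hx hy hz)

/-- The equalizer of two morphisms is a graded Lie subalgebra. -/
theorem Hom.ext_of_lieSpan_eq_top {f g : GrLie.Hom L M} (hX : L.lieSpan X = ⊤)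
    (h : ∀ x ∈ X, f.toLinearMap x = g.toLinearMap x) : f = g := by
  have hS : L.IsLieSub (LinearMap.eqLocus f.toLinearMap g.toLinearMap) := by
    refine ⟨fun x hx n => ?_, fun a ha b hb => ?_⟩
    · rw [LinearMap.mem_eqLocus] at hx ⊢
      rw [GrMod.map_proj_zero fun _ _ => f.map_gr, GrMod.map_proj_zero fun _ _ => g.map_gr, hx]
    · rw [LinearMap.mem_eqLocus] at ha hb ⊢
      rw [f.map_bracket, g.map_bracket, ha, hb]
  have := hX.ge.trans (lieSpan_le hS h)
  exact GrLie.Hom.ext (LinearMap.ext fun x => this (Submodule.mem_top (x := x)))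

/-- A graded Lie subalgebra of the subalgebra is also one of `L`; if it contains `X`, it contains
everything generated by `X`. This lets morphisms out of a generated subalgebra be compared on `X`.
-/
theorem lieSpan_subLie_eq_top (L : GrLie.{u, v} K) (X : Submodule K L) :
    (L.subLie _ (L.isLieSub_lieSpan X)).lieSpan (X.comap (L.lieSpan X).subtype) = ⊤ := by
  have hS := isLieSub_lieSpan (L.subLie _ (L.isLieSub_lieSpan X))
    (X.comap (L.lieSpan X).subtype)
  have hX := le_lieSpan (L := L.subLie _ (L.isLieSub_lieSpan X))
    (X := X.comap (L.lieSpan X).subtype)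
  generalize (L.subLie _ (L.isLieSub_lieSpan X)).lieSpan (X.comap (L.lieSpan X).subtype) = S
    at hS hX ⊢
  have h : L.IsLieSub (Submodule.map (L.lieSpan X).subtype S) := by
    constructor
    · exact hS.graded.map (V := L.toGrMod.sub _ (L.isLieSub_lieSpan X).graded) (W := L.toGrMod)
        fun _ _ h => h
    · rintro _ ⟨a, ha, rfl⟩ _ ⟨b, hb, rfl⟩
      exact ⟨_, hS.bracket_mem a ha b hb, rfl⟩
  have h' := lieSpan_le h (X := X) fun x hx => ⟨⟨x, le_lieSpan hx⟩, hX hx, rfl⟩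
  refine eq_top_iff.2 fun x _ => ?_
  obtain ⟨y, hy, hyx⟩ := h' x.2
  rwa [← Subtype.ext (a1 := y) (a2 := x) hyx]

theorem lieSpan_range_ι (V : GrMod.{u, v} K) :
    (freeLie V).lieSpan (LinearMap.range (freeLie.ι V)) = ⊤ := by
  have hS := isLieSub_lieSpan (freeLie V) (LinearMap.range (freeLie.ι V))
  have hX := le_lieSpan (L := freeLie V) (X := LinearMap.range (freeLie.ι V))
  generalize (freeLie V).lieSpan (LinearMap.range (freeLie.ι V)) = S at hS hX ⊢
  have h : V.IsLieSubalgebraOver (Submodule.map V.freeLieSub.subtype S) := by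
    refine ⟨?_, ?_, fun w => ⟨freeLie.ι V w, hX (LinearMap.mem_range_self _ w), rfl⟩⟩
    · exact hS.graded.map (V := (freeLie V).toGrMod) (W := V.tensorAlgebra) fun _ _ h => h
    · rintro _ ⟨a, ha, rfl⟩ _ ⟨b, hb, rfl⟩
      exact ⟨_, hS.bracket_mem a ha b hb, rfl⟩
  have h' := GrMod.freeLieSub_le h
  refine eq_top_iff.2 fun x _ => ?_
  obtain ⟨y, hy, hyx⟩ := h' x.2
  rwa [← Subtype.ext (a1 := y) (a2 := x) hyx]

end GrLie

theorem freeLie.hom_ext {K : Type u} [Field K] {V : GrMod.{u, v} K} {M : GrLie.{u, max u v} K}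
    {f g : GrLie.Hom (freeLie V) M}
    (h : ∀ x, f.toLinearMap (freeLie.ι V x) = g.toLinearMap (freeLie.ι V x)) : f = g :=
  GrLie.Hom.ext_of_lieSpan_eq_top (GrLie.lieSpan_range_ι V) (by rintro _ ⟨x, rfl⟩; exact h x)

/-! ### DG-Lie subalgebras. -/

namespace DGLie

variable {K : Type u} [Field K]

/-- A graded Lie subalgebra closed under the differential, as a DG-Lie algebra. -/
def subDG (L : DGLie.{u, v} K) (S : Submodule K L) (hS : L.IsLieSub S)
    (hd : ∀ x ∈ S, L.d x ∈ S) : DGLie.{u, v} K where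
  toGrLie := L.subLie S hS
  d := L.d.restrict hd
  d_mem hx := L.d_mem hx
  d_d x := Subtype.ext (L.d_d x.1)
  leibniz hx hy := Subtype.ext (L.leibniz hx hy)

/-- By the Leibniz rule, the elements of the generated subalgebra whose differential stays inside
form a graded Lie subalgebra containing `X`. -/
theorem d_mem_lieSpan (L : DGLie.{u, v} K) {X : Submodule K L}
    (hX : ∀ x ∈ X, L.d x ∈ L.lieSpan X) {x : L} (hx : x ∈ L.lieSpan X) :
    L.d x ∈ L.lieSpan X := by
  have hS := L.isLieSub_lieSpan X
  have h : L.IsLieSub (L.lieSpan X ⊓ (L.lieSpan X).comap L.d) := by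
    refine .of_homogeneous (fun x hx n => ⟨hS.graded x hx.1 n, ?_⟩) ?_
    · change L.d _ ∈ L.lieSpan X
      rw [GrMod.map_proj fun _ _ => L.d_mem]
      exact hS.graded _ hx.2 _
    · rintro i j a ⟨ha, ha'⟩ b ⟨hb, hb'⟩ hi hj
      refine ⟨hS.bracket_mem a ha b hb, ?_⟩
      change L.d _ ∈ L.lieSpan X
      rw [L.leibniz hi hj]
      exact add_mem (hS.bracket_mem _ ha' _ hb) (zsmul_mem (hS.bracket_mem _ ha _ hb') _)
  exact (GrLie.lieSpan_le h (fun x hx => ⟨GrLie.le_lieSpan hx, hX x hx⟩) hx).2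

/-- The inclusion of DG-Lie subalgebras. -/
def subDGInclusion (L : DGLie.{u, v} K) {S T : Submodule K L} {hS : L.IsLieSub S}
    {hT : L.IsLieSub T} {hdS : ∀ x ∈ S, L.d x ∈ S} {hdT : ∀ x ∈ T, L.d x ∈ T} (h : S ≤ T) :
    L.subDG S hS hdS ⟶ L.subDG T hT hdT :=
  DGLie.Hom.mk ⟨Submodule.inclusion h, fun hx => hx, fun _ _ => rfl⟩ fun _ => rfl

/-- The inclusion of a DG-Lie subalgebra. -/
def subDGSubtype (L : DGLie.{u, v} K) {S : Submodule K L} {hS : L.IsLieSub S}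
    {hdS : ∀ x ∈ S, L.d x ∈ S} : L.subDG S hS hdS ⟶ L :=
  DGLie.Hom.mk ⟨S.subtype, fun hx => hx, fun _ _ => rfl⟩ fun _ => rfl

end DGLie

/-! ### Semifree filtrations -/

section Filtration

variable {K : Type u} [Field K] [CharZero K] {V : GrMod.{u, v} K} {L : DGLie.{u, max u v} K}

/-- Every linear map of degree `0` from `V` to a graded Lie algebra extends along `i : V → L`. -/
def DGLie.HasFreeExtensions (L : DGLie.{u, max u v} K) (i : V →ₗ[K] L) : Prop :=
  ∀ (M : GrLie.{u, max u v} K) (φ : V →ₗ[K] M), (∀ n, ∀ x ∈ V.gr n, φ x ∈ M.gr n) →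
    ∃ h : GrLie.Hom L.toGrLie M, ∀ x, h.toLinearMap (i x) = φ x

/-- With `p` a graded projection onto `D`, the space `E ∩ ker p` is a graded complement of `D` in
`E`, and its image `W` in `L` generates the free factor. A pair of morphisms out of the smaller
subalgebra and `𝕃(W)` prescribes a linear map on `V`; freeness of `L` extends it to a morphism,
which is then restricted. Uniqueness holds because `i D` and `W` together span `i E`. -/
theorem elementarySemifree_subDGInclusion {i : V →ₗ[K] L}
    (hi : ∀ n, ∀ x ∈ V.gr n, i x ∈ L.gr n) (hfree : L.HasFreeExtensions i)
    {D E : Submodule K V} (hD : V.IsGraded D) (hE : V.IsGraded E) (hDE : D ≤ E)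
    (hdD : ∀ x ∈ L.lieSpan (D.map i), L.d x ∈ L.lieSpan (D.map i))
    (hdE : ∀ x ∈ L.lieSpan (E.map i), L.d x ∈ L.lieSpan (E.map i))
    (hd : ∀ x ∈ E, L.d (i x) ∈ L.lieSpan (D.map i)) :
    elementarySemifree.{u, v} K
      (L.subDGInclusion (GrLie.lieSpan_mono (Submodule.map_mono hDE)) :
        L.subDG _ (L.isLieSub_lieSpan _) hdD ⟶ L.subDG _ (L.isLieSub_lieSpan _) hdE) := by
  obtain ⟨p, hp, hpD, hpx⟩ := hD.exists_projection
  obtain ⟨q, hq, hqE, hqx⟩ := hE.exists_projection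
  have hX : L.IsGraded ((E ⊓ LinearMap.ker p).map i) := (hE.inf (.ker hp)).map hi
  have hXE : (E ⊓ LinearMap.ker p).map i ≤ L.lieSpan (E.map i) :=
    (Submodule.map_mono inf_le_left).trans GrLie.le_lieSpan
  have hDm : ∀ {x}, x ∈ D → i x ∈ L.lieSpan (D.map i) := fun hx =>
    GrLie.le_lieSpan (Submodule.mem_map_of_mem hx)
  let B := L.subDG _ (L.isLieSub_lieSpan _) hdE
  let W := L.toGrMod.sub _ hX
  let j : freeLie W ⟶ B.toGrLie :=
    freeLie.lift (V := W) (L := B.toGrLie) (Submodule.inclusion hXE) fun _ _ h => h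
  have hj : ∀ x : W, j.toLinearMap (freeLie.ι W x) = Submodule.inclusion hXE x :=
    freeLie.lift_ι (V := W) (L := B.toGrLie) _ _
  have hex : ∀ (T : GrLie.{u, max u v} K)
      (f : GrLie.Hom (L.subDG _ (L.isLieSub_lieSpan _) hdD).toGrLie T)
      (g : GrLie.Hom (freeLie W) T), ∃ h : GrLie.Hom B.toGrLie T,
        (∀ x : D, h.toLinearMap ⟨i x, GrLie.lieSpan_mono (Submodule.map_mono hDE) (hDm x.2)⟩ =
          f.toLinearMap ⟨i x, hDm x.2⟩) ∧
        ∀ x : W, h.toLinearMap (Submodule.inclusion hXE x) =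
          g.toLinearMap (freeLie.ι W x) := by
    intro T f g
    -- `p ∘ q` and `q - p ∘ q` are the components of `V` along `D` and along its complement in `E`.
    have hr : ∀ x, (q - p ∘ₗ q) x ∈ E ⊓ LinearMap.ker p := fun x =>
      ⟨sub_mem (hqE x) (hDE (hpD _)), by simp [hpx _ (hpD _)]⟩
    let α : V →ₗ[K] L.lieSpan (D.map i) :=
      (i ∘ₗ p ∘ₗ q).codRestrict _ fun x => hDm (hpD _)
    let β : V →ₗ[K] W :=
      (i ∘ₗ (q - p ∘ₗ q)).codRestrict ((E ⊓ LinearMap.ker p).map i)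
        fun x => Submodule.mem_map_of_mem (hr x)
    -- This map is `f` on `D`, `g` on the complement of `D` in `E`, and zero on `ker q`.
    let φ : V →ₗ[K] T := f.toLinearMap ∘ₗ α + g.toLinearMap ∘ₗ freeLie.ι W ∘ₗ β
    have hφ : ∀ x a b, α x = a → β x = b →
        φ x = f.toLinearMap a + g.toLinearMap (freeLie.ι W b) := by
      rintro x _ _ rfl rfl; rfl
    obtain ⟨h, hh⟩ := hfree T φ fun n x hx => by
      refine add_mem (f.map_gr (hi _ _ (hp _ _ (hq _ _ hx)))) (g.map_gr ?_)
      exact GrMod.ι_mem (V := W) (hi _ _ (sub_mem (hq _ _ hx) (hp _ _ (hq _ _ hx))))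
    refine ⟨⟨h.toLinearMap ∘ₗ (L.lieSpan (E.map i)).subtype, fun hx => h.map_gr hx,
      fun x y => h.map_bracket _ _⟩, fun x => (hh _).trans ?_, ?_⟩
    · refine (hφ x.1 ⟨i x, hDm x.2⟩ 0 ?_ ?_).trans ?_
      · apply Subtype.ext
        simp [α, hqx _ (hDE x.2), hpx _ x.2]
      · apply Subtype.ext
        change i (q x - p (q x)) = 0
        rw [hqx _ (hDE x.2), hpx _ x.2, sub_self, map_zero]
      · rw [map_zero, map_zero, add_zero]
    · rintro ⟨_, x, ⟨hxE, hxp⟩, rfl⟩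
      rw [SetLike.mem_coe, LinearMap.mem_ker] at hxp
      refine (hh _).trans ((hφ x 0 ⟨i x, Submodule.mem_map_of_mem ⟨hxE, hxp⟩⟩ ?_ ?_).trans ?_)
      · apply Subtype.ext
        change i (p (q x)) = 0
        rw [hqx _ hxE, hxp, map_zero]
      · apply Subtype.ext
        change i (q x - p (q x)) = i x
        rw [hqx _ hxE, hxp, sub_zero]
      · exact (congrArg (· + _) (map_zero f.toLinearMap)).trans (zero_add _)
  have huniq : ∀ (T : GrLie.{u, max u v} K) (h h' : GrLie.Hom B.toGrLie T),
      (∀ x : D, h.toLinearMap ⟨i x, GrLie.lieSpan_mono (Submodule.map_mono hDE) (hDm x.2)⟩ =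
        h'.toLinearMap ⟨i x, GrLie.lieSpan_mono (Submodule.map_mono hDE) (hDm x.2)⟩) →
      (∀ x : W, h.toLinearMap (Submodule.inclusion hXE x) =
        h'.toLinearMap (Submodule.inclusion hXE x)) → h = h' := by
    intro T h h' h1 h2
    refine GrLie.Hom.ext_of_lieSpan_eq_top (GrLie.lieSpan_subLie_eq_top L.toGrLie (E.map i)) ?_
    rintro ⟨_, hy⟩ ⟨x, hx, rfl⟩
    have hxr : x - p x ∈ E ⊓ LinearMap.ker p := ⟨sub_mem hx (hDE (hpD x)), by simp [hpx _ (hpD _)]⟩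
    -- A generator splits along `x = p x + (x - p x)`.
    have e : (⟨i x, hy⟩ : L.lieSpan (E.map i)) =
        ⟨i (p x), GrLie.lieSpan_mono (Submodule.map_mono hDE) (hDm (hpD x))⟩ +
        Submodule.inclusion hXE ⟨i (x - p x), Submodule.mem_map_of_mem hxr⟩ := by
      ext
      simp
    exact (congrArg h.toLinearMap e).trans ((map_add h.toLinearMap _ _).trans
      ((congrArg₂ (· + ·) (h1 ⟨p x, hpD x⟩) (h2 _)).trans
        ((map_add h'.toLinearMap _ _).symm.trans (congrArg h'.toLinearMap e.symm))))
  choose F hF1 hF2 using hex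
  refine ⟨W, j, ⟨Limits.BinaryCofan.IsColimit.mk _ (fun {T} f g => F T f g) ?_ ?_ ?_⟩, ?_⟩
  · intro T f g
    refine GrLie.Hom.ext_of_lieSpan_eq_top (GrLie.lieSpan_subLie_eq_top L.toGrLie (D.map i)) ?_
    rintro ⟨_, hy⟩ ⟨x, hx, rfl⟩
    exact hF1 T f g ⟨x, hx⟩
  · intro T f g
    refine freeLie.hom_ext fun x => ?_
    exact (congrArg (F T f g).toLinearMap (hj x)).trans (hF2 T f g x)
  · intro T f g m hm1 hm2
    refine huniq T m _ (fun x => ?_) fun x => ?_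
    · rw [hF1, ← hm1]; rfl
    · rw [hF2, ← hm2, ← hj]; rfl
  · rintro ⟨_, x, ⟨hxE, hxp⟩, rfl⟩
    rw [hj]
    exact ⟨⟨L.d (i x), hd x hxE⟩, rfl⟩

end Filtration

/-! ### Unions of increasing sequences of DG-Lie subalgebras. -/

section Union

variable {K : Type u} [Field K]

/-- An increasing sequence of DG-Lie subalgebras, as a functor. -/
def DGLie.subDGFunctor (L : DGLie.{u, v} K) (S : ℕ → Submodule K L) (hS : ∀ n, L.IsLieSub (S n))
    (hd : ∀ n, ∀ x ∈ S n, L.d x ∈ S n) (hmono : Monotone S) : ℕ ⥤ DGLie.{u, v} K where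
  obj n := L.subDG (S n) (hS n) (hd n)
  map f := L.subDGInclusion (hmono f.le)
  map_id _ := rfl
  map_comp _ _ := rfl

variable {L : DGLie.{u, v} K} {S : ℕ → Submodule K L} {hS : ∀ n, L.IsLieSub (S n)}
  {hd : ∀ n, ∀ x ∈ S n, L.d x ∈ S n} {hmono : Monotone S}

/-- The cocone of an increasing sequence of DG-Lie subalgebras of `L` with vertex `L`. -/
def DGLie.subDGCoconeι (L : DGLie.{u, v} K) (S : ℕ → Submodule K L) (hS : ∀ n, L.IsLieSub (S n))
    (hd : ∀ n, ∀ x ∈ S n, L.d x ∈ S n) (hmono : Monotone S) :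
    L.subDGFunctor S hS hd hmono ⟶ (Functor.const ℕ).obj L where
  app _ := L.subDGSubtype
  naturality _ _ _ := rfl

/-- Each element is evaluated at a chosen stage containing it. The choice does not matter, because
two stages can be compared at their maximum, so every identity can be checked in one common stage.
-/
theorem DGLie.exists_hom_of_union (hex : ∀ x, ∃ n, x ∈ S n) {T : DGLie.{u, v} K}
    (f : ∀ n, S n →ₗ[K] T) (hf : ∀ m n (h : m ≤ n) (x : S m), f n ⟨x, hmono h x.2⟩ = f m x)
    (hgr : ∀ n i (x : S n), x.1 ∈ L.gr i → f n x ∈ T.gr i)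
    (hbr : ∀ n (x y : S n), f n ⟨L.bracket x y, (hS n).bracket_mem _ x.2 _ y.2⟩ =
      T.bracket (f n x) (f n y))
    (hfd : ∀ n (x : S n), f n ⟨L.d x, hd n _ x.2⟩ = T.d (f n x)) :
    ∃ h : L ⟶ T, ∀ n (x : S n), h.toLinearMap x = f n x := by
  choose k hk using hex
  have key : ∀ n x (hx : x ∈ S n), f (k x) ⟨x, hk x⟩ = f n ⟨x, hx⟩ := fun n x hx => by
    rw [← hf (k x) _ (le_max_left (k x) n) ⟨x, hk x⟩, ← hf n _ (le_max_right (k x) n) ⟨x, hx⟩]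
  have hmax : ∀ x y, ∃ n, x ∈ S n ∧ y ∈ S n := fun x y =>
    ⟨max (k x) (k y), hmono (le_max_left _ _) (hk x), hmono (le_max_right _ _) (hk y)⟩
  let g : L →ₗ[K] T :=
    { toFun := fun x => f (k x) ⟨x, hk x⟩
      map_add' := fun x y => by
        obtain ⟨n, hx, hy⟩ := hmax x y
        rw [key n _ (add_mem hx hy), key n _ hx, key n _ hy, ← map_add]
        rfl
      map_smul' := fun r x => by
        rw [key (k x) _ ((S _).smul_mem r (hk x)), RingHom.id_apply, ← map_smul]
        rfl }
  refine ⟨DGLie.Hom.mk ⟨g, fun {i x} hx => hgr _ _ ⟨x, hk x⟩ hx, fun x y => ?_⟩ fun x => ?_,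
    fun n x => key n x x.2⟩
  · obtain ⟨n, hx, hy⟩ := hmax x y
    change f _ _ = T.bracket (f _ _) (f _ _)
    rw [key n _ ((hS n).bracket_mem _ hx _ hy), key n _ hx, key n _ hy]
    exact hbr n ⟨x, hx⟩ ⟨y, hy⟩
  · change f _ _ = T.d (f _ _)
    rw [key (k x) _ (hd _ _ (hk x))]
    exact hfd _ ⟨x, hk x⟩

theorem DGLie.nonempty_isColimit_subDGCocone (hex : ∀ x, ∃ n, x ∈ S n) :
    Nonempty (Limits.IsColimit (Limits.Cocone.mk L (L.subDGCoconeι S hS hd hmono))) := by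
  have h : ∀ s : Limits.Cocone (L.subDGFunctor S hS hd hmono), ∃ h : L ⟶ s.pt,
      ∀ n (x : S n), h.toLinearMap x = (s.ι.app n).toLinearMap x := fun s =>
    DGLie.exists_hom_of_union (hS := hS) (hd := hd) (hmono := hmono) hex
      (fun n => (s.ι.app n).toLinearMap)
      (fun m n h x => congrArg (fun f => f.toLinearMap x) (s.w (homOfLE h)))
      (fun n _ x hx => (s.ι.app n).map_gr hx)
      (fun n x y => (s.ι.app n).map_bracket x y) (fun n x => (s.ι.app n).map_d x)
  choose F hF using h
  refine ⟨⟨F, fun s n => ?_, fun s m hm => ?_⟩⟩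
  · exact DGLie.Hom.ext (LinearMap.ext fun x => hF s n x)
  · refine DGLie.Hom.ext (LinearMap.ext fun x => ?_)
    obtain ⟨n, hn⟩ := hex x
    exact (congrArg (fun f => f.toLinearMap ⟨x, hn⟩) (hm n)).trans (hF s n ⟨x, hn⟩).symm

theorem GrLie.lieSpan_bot (L : GrLie.{u, v} K) : L.lieSpan ⊥ = ⊥ := by
  refine le_bot_iff.1 (GrLie.lieSpan_le ⟨?_, ?_⟩ le_rfl)
  · rintro x hx n
    rw [Submodule.mem_bot] at hx ⊢
    rw [hx, map_zero]
  · rintro a ha b -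
    rw [Submodule.mem_bot] at ha ⊢
    rw [ha, map_zero, LinearMap.zero_apply]

/-- An increasing union of graded Lie subalgebras is again one, so it is everything as soon as it
contains generators. -/
theorem GrLie.exists_mem_of_lieSpan_eq_top {L : GrLie.{u, v} K} {S : ℕ → Submodule K L}
    (hS : ∀ n, L.IsLieSub (S n)) (hmono : Monotone S) {X : Submodule K L}
    (hX : L.lieSpan X = ⊤) (h : ∀ x ∈ X, ∃ n, x ∈ S n) (x : L) : ∃ n, x ∈ S n := by
  have hmem : ∀ {x}, x ∈ ⨆ n, S n ↔ ∃ n, x ∈ S n :=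
    Submodule.mem_iSup_of_directed _ hmono.directed_le
  have hsup : L.IsLieSub (⨆ n, S n) := by
    constructor
    · intro x hx k
      obtain ⟨n, hn⟩ := hmem.1 hx
      exact hmem.2 ⟨n, (hS n).graded x hn k⟩
    · intro a ha b hb
      obtain ⟨m, hm⟩ := hmem.1 ha
      obtain ⟨n, hn⟩ := hmem.1 hb
      exact hmem.2 ⟨max m n, (hS _).bracket_mem _ (hmono (le_max_left _ _) hm) _
        (hmono (le_max_right _ _) hn)⟩
  exact hmem.1 (GrLie.lieSpan_le hsup (fun x hx => hmem.2 (h x hx)) (hX.ge Submodule.mem_top))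

/-- A DG-Lie algebra `L` that is free on `V` is semifree if `V` has an exhaustive filtration
`0 = D 0 ⊆ D 1 ⊆ ⋯` such that `d` maps `D (n + 1)` to the subalgebra generated by `D n`. -/
theorem DGLie.isSemifree_of_filtration [CharZero K] {V : GrMod.{u, v} K}
    {L : DGLie.{u, max u v} K} {i : V →ₗ[K] L} (hi : ∀ n, ∀ x ∈ V.gr n, i x ∈ L.gr n)
    (hfree : L.HasFreeExtensions i) (hgen : L.lieSpan (LinearMap.range i) = ⊤)
    {D : ℕ → Submodule K V} (hgr : ∀ n, V.IsGraded (D n)) (hD : Monotone D) (hD0 : D 0 = ⊥)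
    (hex : ∀ x, ∃ n, x ∈ D n)
    (hd : ∀ n, ∀ x ∈ D (n + 1), L.d (i x) ∈ L.lieSpan ((D n).map i)) :
    DGLie.IsSemifree.{u, v} L := by
  let S : ℕ → Submodule K L := fun n => L.lieSpan ((D n).map i)
  have hS : ∀ n, L.IsLieSub (S n) := fun n => L.isLieSub_lieSpan _
  have hmono : Monotone S := fun m n h => GrLie.lieSpan_mono (Submodule.map_mono (hD h))
  have hS0 : S 0 = ⊥ := by
    simp only [S, hD0, Submodule.map_bot, GrLie.lieSpan_bot]
  have hdS : ∀ n, ∀ x ∈ S n, L.d x ∈ S n := by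
    intro n x hx
    refine L.d_mem_lieSpan ?_ hx
    rintro _ ⟨y, hy, rfl⟩
    -- The hypothesis on `d` only concerns `D (n + 1)`; stage `0` is stable because `D 0 = 0`.
    cases n with
    | zero =>
      rw [hD0, SetLike.mem_coe, Submodule.mem_bot] at hy
      rw [hy, map_zero, map_zero]
      exact zero_mem _
    | succ n => exact hmono n.le_succ (hd n y hy)
  have hexS : ∀ x, ∃ n, x ∈ S n := by
    refine GrLie.exists_mem_of_lieSpan_eq_top hS hmono hgen ?_
    rintro _ ⟨x, rfl⟩
    obtain ⟨n, hn⟩ := hex x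
    exact ⟨n, GrLie.le_lieSpan (Submodule.mem_map_of_mem hn)⟩
  -- The sequence must start at the zero algebra, which is why `D 0` is required to vanish.
  have hzero : ∀ x : S 0, x = 0 := fun x =>
    Subtype.ext ((Submodule.mem_bot K).1 (hS0.le x.2))
  obtain ⟨hcolim⟩ := DGLie.nonempty_isColimit_subDGCocone (hS := hS) (hd := hdS) (hmono := hmono)
    hexS
  exact ⟨{
    F := L.subDGFunctor S hS hdS hmono
    isoBot :=
      { hom := DGLie.Hom.mk ⟨0, fun _ => Submodule.zero_mem _, fun _ _ => by simp⟩ fun _ => by simp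
        inv := DGLie.initialMap _
        hom_inv_id := DGLie.Hom.ext (LinearMap.ext fun x => (hzero x).symm)
        inv_hom_id := DGLie.Hom.ext (LinearMap.ext fun x => rfl) }
    incl := L.subDGCoconeι S hS hdS hmono
    isColimit := hcolim
    fac := DGLie.Hom.ext (LinearMap.ext fun x => rfl)
    map_mem := fun n _ => elementarySemifree_subDGInclusion hi hfree (hgr n) (hgr (n + 1))
      (hD n.le_succ) (hdS n) (hdS (n + 1)) (hd n) }⟩

end Union

/-! ### The conilpotency filtration -/

/-! ### Homogeneous components in `V ⊗ V`. -/

section TensorProj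

variable {K : Type u} [Field K] (V : GrMod.{u, v} K)

/-- The projection of `V ⊗ V` onto its homogeneous component of degree `n`. -/
def GrMod.tensorProj (n : ℤ) : V ⊗[K] V →ₗ[K] V ⊗[K] V :=
  TensorProduct.lift (V.desc fun i =>
    (TensorProduct.mk K V V).compl₂ (V.proj (n - i)) ∘ₗ (V.gr i).subtype)

theorem GrMod.tensorProj_tmul (n : ℤ) {i : ℤ} {x : V} (hx : x ∈ V.gr i) (y : V) :
    V.tensorProj n (x ⊗ₜ y) = x ⊗ₜ V.proj (n - i) y := by
  rw [tensorProj, TensorProduct.lift.tmul, V.desc_of_mem _ hx]; rfl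

theorem GrMod.tensorProj_of_mem {n : ℤ} {t : V ⊗[K] V} (ht : t ∈ V.tensorGr n) :
    V.tensorProj n t = t := by
  suffices h : Set.EqOn (V.tensorProj n) (LinearMap.id (R := K) (M := V ⊗[K] V)) _ from
    LinearMap.eqOn_span h ht
  rintro _ ⟨i, j, hij, x, hx, y, hy, rfl⟩
  rw [V.tensorProj_tmul n hx, show n - i = j by omega, V.proj_of_mem hy, LinearMap.id_apply]

theorem GrMod.tensorProj_of_mem_ne {m n : ℤ} {t : V ⊗[K] V} (ht : t ∈ V.tensorGr m)
    (hmn : m ≠ n) : V.tensorProj n t = 0 := by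
  suffices h : Set.EqOn (V.tensorProj n) (0 : V ⊗[K] V →ₗ[K] V ⊗[K] V) _ from
    LinearMap.eqOn_span h ht
  rintro _ ⟨i, j, hij, x, hx, y, hy, rfl⟩
  rw [V.tensorProj_tmul n hx, V.proj_of_mem_ne hy (by omega), TensorProduct.tmul_zero,
    LinearMap.zero_apply]

variable {V} in
theorem GrMod.IsGraded.tensorProj_mem {D : Submodule K V} (hD : V.IsGraded D) (n : ℤ)
    {t : V ⊗[K] V} (ht : t ∈ Submodule.map₂ (TensorProduct.mk K V V) ⊤ D) :
    V.tensorProj n t ∈ Submodule.map₂ (TensorProduct.mk K V V) ⊤ D := by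
  suffices h : Submodule.map₂ (TensorProduct.mk K V V) ⊤ D ≤
      (Submodule.map₂ (TensorProduct.mk K V V) ⊤ D).comap (V.tensorProj n) from h ht
  refine Submodule.map₂_le.2 fun x hx y hy => ?_
  clear hx
  rw [Submodule.mem_comap, TensorProduct.mk_apply]
  induction x using V.induction with
  | h0 => simp
  | hom i x hx =>
    rw [V.tensorProj_tmul n hx]
    exact Submodule.apply_mem_map₂ _ Submodule.mem_top (hD y hy _)
  | hadd x z hx hz => rw [TensorProduct.add_tmul, map_add]; exact add_mem hx hz

end TensorProj

/-- Let `e` be a linear projection onto `D`. Both `id ⊗ e` and `e ⊗ id` fix `t`, hence so does `e ⊗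
e`, whose image lies in `D ⊗ D`. -/
theorem mem_map₂_mk_of_mem {K : Type u} [Field K] {V : Type v} [AddCommGroup V] [Module K V]
    {D : Submodule K V} {t : V ⊗[K] V} (h₁ : t ∈ Submodule.map₂ (TensorProduct.mk K V V) ⊤ D)
    (h₂ : t ∈ Submodule.map₂ (TensorProduct.mk K V V) D ⊤) :
    t ∈ Submodule.map₂ (TensorProduct.mk K V V) D D := by
  obtain ⟨q, hq⟩ := LinearMap.exists_leftInverse_of_injective D.subtype D.ker_subtype
  have hqD : ∀ x ∈ D, (D.subtype ∘ₗ q) x = x := fun x hx =>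
    congrArg Subtype.val (LinearMap.congr_fun hq ⟨x, hx⟩)
  have e₁ : Submodule.map₂ (TensorProduct.mk K V V) ⊤ D ≤
      LinearMap.eqLocus ((D.subtype ∘ₗ q).lTensor V) LinearMap.id :=
    Submodule.map₂_le.2 fun x _ y hy => by simpa using congrArg (x ⊗ₜ[K] ·) (hqD y hy)
  have e₂ : Submodule.map₂ (TensorProduct.mk K V V) D ⊤ ≤
      LinearMap.eqLocus ((D.subtype ∘ₗ q).rTensor V) LinearMap.id :=
    Submodule.map₂_le.2 fun x hx y _ => by simpa using congrArg (· ⊗ₜ[K] y) (hqD x hx)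
  have h : TensorProduct.map (D.subtype ∘ₗ q) (D.subtype ∘ₗ q) t = t := by
    rw [← LinearMap.lTensor_comp_rTensor, LinearMap.comp_apply,
      show (D.subtype ∘ₗ q).rTensor V t = t from e₂ h₂]
    exact e₁ h₁
  have hr : LinearMap.range (D.subtype ∘ₗ q) ≤ D := by
    rintro _ ⟨x, rfl⟩; exact (q x).2
  have := LinearMap.mem_range_self (TensorProduct.map (D.subtype ∘ₗ q) (D.subtype ∘ₗ q)) t
  rw [h, TensorProduct.range_map] at this
  exact Submodule.map₂_le_map₂ hr hr this

/-! ### Kernels of the iterated coproducts and the cobar differential. -/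

namespace GrCoalg

variable {K : Type u} [Field K] (C : GrCoalg.{u, v} K)

theorem Δ_proj (n : ℤ) (x : C) : C.Δ (C.proj n x) = C.tensorProj n (C.Δ x) := by
  suffices h : C.Δ ∘ₗ C.proj n = C.tensorProj n ∘ₗ C.Δ from LinearMap.congr_fun h x
  refine C.hom_ext fun i x hx => ?_
  simp only [LinearMap.comp_apply]
  by_cases h : i = n
  · subst h
    rw [C.proj_of_mem hx, C.tensorProj_of_mem (C.Δ_mem hx)]
  · rw [C.proj_of_mem_ne hx h, C.tensorProj_of_mem_ne (C.Δ_mem hx) h, map_zero]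

/-- Tensoring with `C` is exact over a field, so the kernel of `id ⊗ Δⁿ` is `C ⊗ ker Δⁿ`. This
recursion drives the inductions on the filtration. -/
theorem mem_ker_iterΔ_succ {n : ℕ} {x : C} : x ∈ LinearMap.ker (C.iterΔ (n + 1)) ↔
    C.Δ x ∈ Submodule.map₂ (TensorProduct.mk K C C) ⊤ (LinearMap.ker (C.iterΔ n)) := by
  have h := Module.Flat.lTensor_exact C (LinearMap.exact_subtype_ker_map (C.iterΔ n))
  rw [LinearMap.mem_ker]
  refine (h (C.Δ x)).trans ?_
  rw [← LinearMap.coe_range, SetLike.mem_coe, LinearMap.lTensor,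
    TensorProduct.range_map, LinearMap.range_id, Submodule.range_subtype]

theorem isGraded_ker_iterΔ (n : ℕ) : C.IsGraded (LinearMap.ker (C.iterΔ n)) := by
  induction n with
  | zero =>
    intro x hx n
    change x = 0 at hx
    rw [hx, map_zero]
    exact Submodule.zero_mem _
  | succ n ih =>
    intro x hx k
    rw [mem_ker_iterΔ_succ] at hx ⊢
    rw [Δ_proj]
    exact ih.tensorProj_mem k hx

theorem monotone_ker_iterΔ : Monotone fun n => LinearMap.ker (C.iterΔ n) := by
  refine monotone_nat_of_le_succ fun n => ?_
  induction n with
  | zero =>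
    intro x hx
    change x = 0 at hx
    rw [hx]
    exact Submodule.zero_mem _
  | succ n ih =>
    intro x hx
    rw [mem_ker_iterΔ_succ] at hx ⊢
    exact Submodule.map₂_le_map₂_right ih hx

variable {C}

/-- The Koszul sign depends on the degree of the factor in `D`, so that factor is first split into
components, which stay in `D` because `D` is graded. -/
theorem twist_mem {D : Submodule K C} (hD : C.IsGraded D) {t : C ⊗[K] C}
    (ht : t ∈ Submodule.map₂ (TensorProduct.mk K C C) ⊤ D) :
    C.twist t ∈ Submodule.map₂ (TensorProduct.mk K C C) D ⊤ := by
  suffices h : Submodule.map₂ (TensorProduct.mk K C C) ⊤ D ≤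
      (Submodule.map₂ (TensorProduct.mk K C C) D ⊤).comap C.twist from h ht
  refine Submodule.map₂_le.2 fun x hx y hy => ?_
  clear hx
  rw [Submodule.mem_comap, TensorProduct.mk_apply]
  induction x using C.induction with
  | h0 => simp
  | hom i x hx =>
    obtain ⟨s, hs⟩ := C.exists_sum_proj y
    rw [← hs, TensorProduct.tmul_sum, map_sum]
    refine sum_mem fun j _ => ?_
    rw [C.twist_tmul hx (C.proj_mem j y)]
    exact zsmul_mem (Submodule.apply_mem_map₂ _ (hD y hy j) Submodule.mem_top) _
  | hadd x z hx hz => rw [TensorProduct.add_tmul, map_add]; exact add_mem hx hz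

/-- The recursion for `Δⁿ⁺¹` only controls the right factor; invariance of `Δ x` under the twist
transfers the control to the left one. -/
theorem Δ_mem_map₂_ker_iterΔ (hC : C.IsCocommutative) {n : ℕ} {x : C}
    (hx : x ∈ LinearMap.ker (C.iterΔ (n + 1))) :
    C.Δ x ∈ Submodule.map₂ (TensorProduct.mk K C C) (LinearMap.ker (C.iterΔ n))
      (LinearMap.ker (C.iterΔ n)) := by
  rw [mem_ker_iterΔ_succ] at hx
  refine mem_map₂_mk_of_mem hx ?_
  rw [← show C.twist (C.Δ x) = C.Δ x from LinearMap.congr_fun hC x]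
  exact twist_mem (C.isGraded_ker_iterΔ n) hx

theorem cobarBracket_mem {D : Submodule K C} (hD : C.IsGraded D) {t : C ⊗[K] C}
    (ht : t ∈ Submodule.map₂ (TensorProduct.mk K C C) D D) :
    C.cobarBracket t ∈ ((freeLie C.shift).lieSpan
      ((D.map C.susp.toLinearMap).map (freeLie.ι C.shift))).map C.shift.freeLieSub.subtype := by
  refine Submodule.mem_comap.1 ((?_ : Submodule.map₂ (TensorProduct.mk K C C) D D ≤ _) ht)
  refine Submodule.map₂_le.2 fun x hx y hy => ?_
  have hmem : ∀ z ∈ D, freeLie.ι C.shift (C.susp z) ∈ (freeLie C.shift).lieSpan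
      ((D.map C.susp.toLinearMap).map (freeLie.ι C.shift)) := fun z hz =>
    GrLie.le_lieSpan (Submodule.mem_map_of_mem (Submodule.mem_map_of_mem hz))
  exact ⟨_, (GrLie.isLieSub_lieSpan _ _).bracket_mem _ (hmem _ (hD.sgn_mem 1 hx)) _ (hmem y hy),
    rfl⟩

/-- The expression of `d (s x)` as half a sum of brackets is needed here: the tensor formula would
only place it in the associative subalgebra generated by `s D`. -/
theorem cobar_d_mem [CharZero K] (hC : C.IsCocommutative) {D : Submodule K C} (hD : C.IsGraded D)
    {x : C} (hx : C.Δ x ∈ Submodule.map₂ (TensorProduct.mk K C C) D D) :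
    (C.cobar hC).d (freeLie.ι C.shift (C.susp x)) ∈ (freeLie C.shift).lieSpan
      ((D.map C.susp.toLinearMap).map (freeLie.ι C.shift)) := by
  have h := Submodule.smul_mem _ (2⁻¹ : K) (cobarBracket_mem hD hx)
  rw [← C.cobarGen_eq hC x] at h
  obtain ⟨y, hy, hyx⟩ := h
  have : (C.cobar hC).d (freeLie.ι C.shift (C.susp x)) = y := by
    refine Subtype.ext ?_
    exact (C.shift.der_ι C.cobarGen (C.susp x)).trans hyx.symm
  rw [this]
  exact hy

end GrCoalg

end DGLieCobar

end

theorem mainTheorem3 {K : Type u} [Field K] [CharZero K] (C : DGLieCobar.GrCoalg.{u, v} K)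
    (hC : C.IsCocommutative) (hC' : C.IsLocallyConilpotent) :
    DGLieCobar.DGLie.IsSemifree.{u, v} (C.cobar hC) := by
  refine DGLieCobar.DGLie.isSemifree_of_filtration (V := C.shift) (L := C.cobar hC)
    (i := DGLieCobar.freeLie.ι C.shift)
    -- With `Δ⁰ = id`, the index `n` is exactly the one for which `D 0 = 0`.
    (D := fun n => (LinearMap.ker (C.iterΔ n)).map C.susp.toLinearMap)
    (fun _ _ hx => DGLieCobar.GrMod.ι_mem hx)
    (fun M φ hφ => ⟨DGLieCobar.freeLie.lift (L := M) φ hφ, DGLieCobar.freeLie.lift_ι φ hφ⟩)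
    (DGLieCobar.GrLie.lieSpan_range_ι C.shift)
    (fun n => (C.isGraded_ker_iterΔ n).map_of_degree fun _ _ => C.susp_mem)
    (fun m n h => Submodule.map_mono (C.monotone_ker_iterΔ h)) ?_ ?_ ?_
  · rw [eq_bot_iff]
    rintro _ ⟨x, hx, rfl⟩
    exact hx
  · intro x
    obtain ⟨n, hn⟩ := hC' (C.susp.symm x)
    exact ⟨n, _, hn, rfl⟩
  · rintro n _ ⟨x, hx, rfl⟩
    exact C.cobar_d_mem hC (C.isGraded_ker_iterΔ n)
      (DGLieCobar.GrCoalg.Δ_mem_map₂_ker_iterΔ hC hx)
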